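/- Let $G\subset GL_n(\mathbb R)$ be a connected reductive real algebraic group (a Zariski closed, Zariski connected subgroup of $GL_n(\mathbb R)$ with trivial unipotent radical), with Lie algebra $\mathfrak g$ and radical $R$. Let $\Gamma=\langle a_1,b_1,\dots,a_g,b_g \mid [a_1,b_1]\cdots[a_g,b_g]=1\rangle$ be the fundamental group of a closed orientable surface of genus $g>1$, with Euler characteristic $\chi(\Gamma)=2-2g$. Give $Hom(\Gamma,G)$ the topology of pointwise convergence, where $G$ has its usual Lie group topology. Call a homomorphism $\phi:\Gamma\to G$ *smooth* if $$\dim Z^1(\Gamma,\mathfrak g_{Ad\circ\phi})=(1-\chi(\Gamma))\dim G+\dim R,$$ where $Z^1(\Gamma,\mathfrak g_{Ad\circ\phi})$ is the space of $1$-cocycles with values in $\mathfrak g$ (the Zariski tangent space of $Hom(\Gamma,G)$ at $\phi$), and call $\phi$ *flexible* if smooth homomorphisms are dense in a neighborhood of $\phi$ in $Hom(\Gamma,G)$. Then the trivial homomorphism $\Gamma\to G$ can be deformed into flexible homomorphisms: it lies in the closure in $Hom(\Gamma,G)$ of the set of flexible homomorphisms, and indeed in the closure of the set of smooth homomorphisms.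 -/

import Mathlib

open Topology

noncomputable section

namespace SurfaceRep

attribute [local instance 100] LieRing.ofAssociativeRing

/-! ### Real linear algebraic groups -/

/-- The coordinates `(i, j) ↦ g i j` of an invertible matrix, as a point of affine space. -/
def entries {n : ℕ} (g : GL (Fin n) ℝ) : Fin n × Fin n → ℝ :=
  fun ij => (g : Matrix (Fin n) (Fin n) ℝ) ij.1 ij.2

/-- The Zariski topology on `GL n ℝ`: a basis of open sets is given by the non-vanishing loci of
real polynomials in the matrix entries, so the closed sets are the common zero sets in `GL n ℝ` of
families of such polynomials. -/
abbrev zariskiTopology (n : ℕ) : TopologicalSpace (GL (Fin n) ℝ) :=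
  TopologicalSpace.generateFrom
    {U | ∃ p : MvPolynomial (Fin n × Fin n) ℝ, U = {g | MvPolynomial.eval (entries g) p ≠ 0}}

/-- A (linear) real algebraic group: a Zariski closed subgroup of `GL n ℝ`. -/
def IsAlgebraic {n : ℕ} (G : Subgroup (GL (Fin n) ℝ)) : Prop :=
  IsClosed[zariskiTopology n] (G : Set (GL (Fin n) ℝ))

/-- Connectedness in the Zariski topology. It is implied by connectedness in the usual (Lie group)
topology, which is finer. -/
def IsZariskiConnected {n : ℕ} (G : Subgroup (GL (Fin n) ℝ)) : Prop :=
  @IsConnected _ (zariskiTopology n) (G : Set (GL (Fin n) ℝ))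

/-- All elements of the subgroup are unipotent matrices. -/
def IsUnipotent {n : ℕ} (U : Subgroup (GL (Fin n) ℝ)) : Prop :=
  ∀ u ∈ U, IsNilpotent ((u : Matrix (Fin n) (Fin n) ℝ) - 1)

/-- The unipotent radical of `G` is trivial: every connected normal unipotent algebraic subgroup
of `G` is trivial. -/
def IsReductive {n : ℕ} (G : Subgroup (GL (Fin n) ℝ)) : Prop :=
  ∀ U : Subgroup (GL (Fin n) ℝ), U ≤ G → IsAlgebraic U → IsZariskiConnected U →
    (∀ g ∈ G, ∀ u ∈ U, g * u * g⁻¹ ∈ U) → IsUnipotent U → U = ⊥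

/-! ### The Lie algebra and the adjoint representation -/

/-- The polynomials in the matrix entries which vanish on `G`. -/
def vanishingIdeal {n : ℕ} (G : Subgroup (GL (Fin n) ℝ)) :
    Ideal (MvPolynomial (Fin n × Fin n) ℝ) where
  carrier := {p | ∀ g ∈ G, MvPolynomial.eval (entries g) p = 0}
  add_mem' ha hb g hg := by simp [ha g hg, hb g hg]
  zero_mem' g _ := by simp
  smul_mem' c p hp g hg := by simp [hp g hg]

lemma mem_vanishingIdeal {n : ℕ} {G : Subgroup (GL (Fin n) ℝ)}
    {p : MvPolynomial (Fin n × Fin n) ℝ} :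
    p ∈ vanishingIdeal G ↔ ∀ g ∈ G, MvPolynomial.eval (entries g) p = 0 := Iff.rfl

/-- The derivative at the identity matrix, in the direction `X`, of a polynomial function. -/
def derivAtOne {n : ℕ} (X : Matrix (Fin n) (Fin n) ℝ) (p : MvPolynomial (Fin n × Fin n) ℝ) : ℝ :=
  ∑ ij : Fin n × Fin n, X ij.1 ij.2 * MvPolynomial.eval (entries 1) (MvPolynomial.pderiv ij p)

/-- The derivation of the polynomial ring which is the left invariant vector field `X`. -/
def leftInv {n : ℕ} (X : Matrix (Fin n) (Fin n) ℝ) :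
    Derivation ℝ (MvPolynomial (Fin n × Fin n) ℝ) (MvPolynomial (Fin n × Fin n) ℝ) :=
  MvPolynomial.mkDerivation ℝ fun ij =>
    ∑ k, MvPolynomial.X (ij.1, k) * MvPolynomial.C (X k ij.2)

/-- Precomposition of polynomial functions with left translation by `g`. -/
def leftTrans {n : ℕ} (g : GL (Fin n) ℝ) :
    MvPolynomial (Fin n × Fin n) ℝ →ₐ[ℝ] MvPolynomial (Fin n × Fin n) ℝ :=
  MvPolynomial.aeval fun ij => ∑ k, MvPolynomial.C (g.1 ij.1 k) * MvPolynomial.X (k, ij.2)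

/-- Precomposition of polynomial functions with right translation by `g`. -/
def rightTrans {n : ℕ} (g : GL (Fin n) ℝ) :
    MvPolynomial (Fin n × Fin n) ℝ →ₐ[ℝ] MvPolynomial (Fin n × Fin n) ℝ :=
  MvPolynomial.aeval fun ij => ∑ k, MvPolynomial.X (ij.1, k) * MvPolynomial.C (g.1 k ij.2)

section helpers

lemma leftInv_X {n : ℕ} (X : Matrix (Fin n) (Fin n) ℝ) (ij : Fin n × Fin n) :
    leftInv X (MvPolynomial.X ij) =
      ∑ k, MvPolynomial.X (ij.1, k) * MvPolynomial.C (X k ij.2) := by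
  simp [leftInv]

lemma eval_leftTrans {n : ℕ} (g h : GL (Fin n) ℝ) (p : MvPolynomial (Fin n × Fin n) ℝ) :
    MvPolynomial.eval (entries h) (leftTrans g p) = MvPolynomial.eval (entries (g * h)) p := by
  induction p using MvPolynomial.induction_on with
  | C a => simp [leftTrans]
  | add p q hp hq => simp [hp, hq]
  | mul_X p ij hp =>
    rw [map_mul, map_mul, map_mul, hp]
    simp [leftTrans, entries, Matrix.mul_apply]

lemma eval_rightTrans {n : ℕ} (g h : GL (Fin n) ℝ) (p : MvPolynomial (Fin n × Fin n) ℝ) :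
    MvPolynomial.eval (entries h) (rightTrans g p) = MvPolynomial.eval (entries (h * g)) p := by
  induction p using MvPolynomial.induction_on with
  | C a => simp [rightTrans]
  | add p q hp hq => simp [hp, hq]
  | mul_X p ij hp =>
    rw [map_mul, map_mul, map_mul, hp]
    simp [rightTrans, entries, Matrix.mul_apply]

lemma leftTrans_leftInv {n : ℕ} (g : GL (Fin n) ℝ) (X : Matrix (Fin n) (Fin n) ℝ)
    (p : MvPolynomial (Fin n × Fin n) ℝ) :
    leftTrans g (leftInv X p) = leftInv X (leftTrans g p) := by
  induction p using MvPolynomial.induction_on with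
  | C a => simp [leftTrans, leftInv]
  | add p q hp hq => simp [hp, hq]
  | mul_X p ij hp =>
    have key : leftTrans g (leftInv X (MvPolynomial.X ij)) =
        leftInv X (leftTrans g (MvPolynomial.X ij)) := by
      simp only [leftInv_X, leftTrans, map_sum, map_mul, MvPolynomial.aeval_X,
        MvPolynomial.algHom_C, Derivation.leibniz, MvPolynomial.algebraMap_eq,
        MvPolynomial.derivation_C, smul_eq_mul, mul_zero, add_zero, Finset.sum_mul,
        Finset.mul_sum]
      rw [Finset.sum_comm]
      simp only [mul_assoc]
    simp only [Derivation.leibniz, map_add, map_mul, smul_eq_mul, hp, key]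

lemma rightTrans_leftInv {n : ℕ} (g : GL (Fin n) ℝ) (X : Matrix (Fin n) (Fin n) ℝ)
    (p : MvPolynomial (Fin n × Fin n) ℝ) :
    rightTrans g (leftInv X p) = leftInv (g.1 * X * g⁻¹.1) (rightTrans g p) := by
  induction p using MvPolynomial.induction_on with
  | C a => simp [rightTrans, leftInv]
  | add p q hp hq => simp [hp, hq]
  | mul_X p ij hp =>
    have hmul : (g.1 * X * g⁻¹.1) * g.1 = g.1 * X := by
      rw [mul_assoc, ← Units.val_mul, inv_mul_cancel, Units.val_one, mul_one]
    have key : rightTrans g (leftInv X (MvPolynomial.X ij)) =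
        leftInv (g.1 * X * g⁻¹.1) (rightTrans g (MvPolynomial.X ij)) := by
      set Y := g.1 * X * g⁻¹.1
      have hm : ∀ l, ∑ k, g.1 l k * X k ij.2 = ∑ k, Y l k * g.1 k ij.2 := fun l => by
        rw [← Matrix.mul_apply, ← Matrix.mul_apply, hmul]
      simp only [leftInv_X, rightTrans, map_sum, map_mul, MvPolynomial.aeval_X,
        MvPolynomial.algHom_C, Derivation.leibniz, MvPolynomial.algebraMap_eq,
        MvPolynomial.derivation_C, smul_eq_mul, mul_zero, zero_add, Finset.sum_mul,
        Finset.mul_sum]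
      rw [Finset.sum_comm]
      conv_rhs => rw [Finset.sum_comm]
      refine Finset.sum_congr rfl fun l _ => ?_
      have h1 := congrArg (fun r : ℝ => (MvPolynomial.X (ij.1, l) :
        MvPolynomial (Fin n × Fin n) ℝ) * MvPolynomial.C r) (hm l)
      simp only [map_sum, map_mul, Finset.mul_sum] at h1
      simp only [mul_assoc] at h1 ⊢
      rw [h1]
      exact Finset.sum_congr rfl fun k _ => by ring
    simp only [Derivation.leibniz, map_add, map_mul, smul_eq_mul, hp, key]

lemma eval_one_leftInv {n : ℕ} (X : Matrix (Fin n) (Fin n) ℝ)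
    (p : MvPolynomial (Fin n × Fin n) ℝ) :
    MvPolynomial.eval (entries 1) (leftInv X p) = derivAtOne X p := by
  induction p using MvPolynomial.induction_on with
  | C a => simp [leftInv, derivAtOne]
  | add p q hp hq => simp [hp, hq, derivAtOne, mul_add, Finset.sum_add_distrib]
  | mul_X p ij hp =>
    have h1 : MvPolynomial.eval (entries 1) (leftInv X (MvPolynomial.X ij)) = X ij.1 ij.2 := by
      simp [leftInv_X, entries, Matrix.one_apply]
    have h2 : derivAtOne X (MvPolynomial.X ij) = X ij.1 ij.2 := by
      simp only [derivAtOne, MvPolynomial.pderiv_X]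
      rw [Finset.sum_eq_single ij]
      · simp
      · intro b _ hb
        simp [hb.symm]
      · simp
    have h3 : derivAtOne X (p * MvPolynomial.X ij) =
        MvPolynomial.eval (entries 1) p * derivAtOne X (MvPolynomial.X ij) +
          MvPolynomial.eval (entries 1) (MvPolynomial.X ij) * derivAtOne X p := by
      simp only [derivAtOne, Derivation.leibniz, smul_eq_mul, map_add, map_mul, mul_add,
        Finset.sum_add_distrib, Finset.mul_sum]
      congr 1 <;> exact Finset.sum_congr rfl fun k _ => by ring
    rw [h3, Derivation.leibniz]
    simp only [smul_eq_mul, map_add, map_mul, h1, h2, hp]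

lemma leftInv_mem {n : ℕ} {G : Subgroup (GL (Fin n) ℝ)} {X : Matrix (Fin n) (Fin n) ℝ}
    (hX : ∀ p ∈ vanishingIdeal G, derivAtOne X p = 0)
    {p : MvPolynomial (Fin n × Fin n) ℝ} (hp : p ∈ vanishingIdeal G) :
    leftInv X p ∈ vanishingIdeal G := by
  intro g hg
  have h := eval_leftTrans g 1 (leftInv X p)
  rw [mul_one] at h
  rw [← h, leftTrans_leftInv, eval_one_leftInv]
  refine hX _ fun h hh => ?_
  rw [eval_leftTrans]
  exact hp _ (G.mul_mem hg hh)

lemma leftInv_lie {n : ℕ} (X Y : Matrix (Fin n) (Fin n) ℝ) :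
    leftInv ⁅X, Y⁆ = ⁅leftInv X, leftInv Y⁆ := by
  refine MvPolynomial.derivation_ext fun ij => ?_
  have aux : ∀ A B : Matrix (Fin n) (Fin n) ℝ,
      leftInv A (leftInv B (MvPolynomial.X ij)) =
        ∑ k, MvPolynomial.X (ij.1, k) * MvPolynomial.C ((A * B) k ij.2) := fun A B => by
    simp only [leftInv_X, map_sum, Derivation.leibniz, MvPolynomial.derivation_C, smul_eq_mul,
      mul_zero, zero_add, Matrix.mul_apply, map_mul, Finset.mul_sum]
    rw [Finset.sum_comm]
    exact Finset.sum_congr rfl fun k _ => Finset.sum_congr rfl fun l _ => by ring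
  rw [Derivation.commutator_apply, aux, aux, leftInv_X, ← Finset.sum_sub_distrib]
  simp [Ring.lie_def, mul_sub]

end helpers

/-- The Lie algebra of `G`: the Zariski tangent space of `G` at the identity, with the commutator
bracket of matrices. -/
def lieAlgebra {n : ℕ} (G : Subgroup (GL (Fin n) ℝ)) :
    LieSubalgebra ℝ (Matrix (Fin n) (Fin n) ℝ) where
  carrier := {X | ∀ p ∈ vanishingIdeal G, derivAtOne X p = 0}
  add_mem' {X Y} hX hY p hp := by
    have h : derivAtOne (X + Y) p = derivAtOne X p + derivAtOne Y p := by
      simp [derivAtOne, add_mul, Finset.sum_add_distrib]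
    rw [h, hX p hp, hY p hp, add_zero]
  zero_mem' p _ := by simp [derivAtOne]
  smul_mem' c X hX p hp := by
    have h : derivAtOne (c • X) p = c * derivAtOne X p := by
      simp [derivAtOne, mul_assoc, Finset.mul_sum]
    rw [h, hX p hp, mul_zero]
  lie_mem' {X Y} hX hY p hp := by
    rw [← eval_one_leftInv, leftInv_lie, Derivation.commutator_apply]
    exact (vanishingIdeal G).sub_mem (leftInv_mem hX (leftInv_mem hY hp))
      (leftInv_mem hY (leftInv_mem hX hp)) 1 G.one_mem

lemma conj_mem_lieAlgebra {n : ℕ} {G : Subgroup (GL (Fin n) ℝ)} {g : GL (Fin n) ℝ} (hg : g ∈ G)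
    {X : Matrix (Fin n) (Fin n) ℝ} (hX : X ∈ lieAlgebra G) :
    (g : Matrix (Fin n) (Fin n) ℝ) * X * ((g⁻¹ : GL (Fin n) ℝ) : Matrix (Fin n) (Fin n) ℝ) ∈
      lieAlgebra G := by
  intro p hp
  have hq : rightTrans g⁻¹ p ∈ vanishingIdeal G := fun h hh => by
    rw [eval_rightTrans]
    exact hp _ (G.mul_mem hh (G.inv_mem hg))
  have hqp : ∀ h, MvPolynomial.eval (entries h) (rightTrans g (rightTrans g⁻¹ p)) =
      MvPolynomial.eval (entries h) p := fun h => by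
    rw [eval_rightTrans, eval_rightTrans, mul_inv_cancel_right]
  have hcomp : rightTrans g (rightTrans g⁻¹ p) = p := by
    have hid : (rightTrans g).comp (rightTrans g⁻¹) =
        AlgHom.id ℝ (MvPolynomial (Fin n × Fin n) ℝ) := by
      refine MvPolynomial.algHom_ext fun ij => ?_
      have hm : ∀ l, ∑ k, g.1 l k * g⁻¹.1 k ij.2 = if l = ij.2 then 1 else 0 := fun l => by
        rw [← Matrix.mul_apply, ← Units.val_mul, mul_inv_cancel, Units.val_one,
          Matrix.one_apply]
      simp only [rightTrans, AlgHom.comp_apply, MvPolynomial.aeval_X, map_sum, map_mul,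
        MvPolynomial.algHom_C, MvPolynomial.algebraMap_eq, Finset.sum_mul, AlgHom.id_apply]
      rw [Finset.sum_comm]
      simp only [mul_assoc, ← MvPolynomial.C_mul, ← Finset.mul_sum, ← map_sum, hm]
      simp
    exact congrArg (fun f : MvPolynomial (Fin n × Fin n) ℝ →ₐ[ℝ]
      MvPolynomial (Fin n × Fin n) ℝ => f p) hid
  have h := rightTrans_leftInv g X (rightTrans g⁻¹ p)
  rw [hcomp] at h
  have h1 := eval_one_leftInv (g.1 * X * g⁻¹.1) p
  rw [← h, eval_rightTrans, one_mul] at h1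
  exact h1.symm.trans (leftInv_mem hX hq g hg)

/-- The adjoint representation `g ↦ (X ↦ g X g⁻¹)` of `G` on its Lie algebra. -/
def adjoint {n : ℕ} (G : Subgroup (GL (Fin n) ℝ)) : Representation ℝ G (lieAlgebra G) where
  toFun g :=
    { toFun := fun X => ⟨(g.1 : Matrix (Fin n) (Fin n) ℝ) * X.1 *
        ((g.1⁻¹ : GL (Fin n) ℝ) : Matrix (Fin n) (Fin n) ℝ), conj_mem_lieAlgebra g.2 X.2⟩
      map_add' := fun X Y => Subtype.ext (by simp [mul_add, add_mul])
      map_smul' := fun c X => Subtype.ext (by simp) }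
  map_one' := LinearMap.ext fun X => Subtype.ext (by simp)
  map_mul' g h := LinearMap.ext fun X => Subtype.ext (by simp [mul_assoc])

/-! ### Surface groups and their representation spaces -/

/-- The fundamental group of the closed orientable surface of genus `γ`, in its standard
presentation `⟨a₁, b₁, …, a_γ, b_γ | [a₁, b₁] ⋯ [a_γ, b_γ] = 1⟩`; `(i, false)` stands for `aᵢ` and
`(i, true)` for `bᵢ`. -/
abbrev SurfaceGroup (γ : ℕ) : Type :=
  PresentedGroup
    {(List.ofFn fun i : Fin γ => FreeGroup.of (i, false) * FreeGroup.of (i, true) *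
      (FreeGroup.of (i, false))⁻¹ * (FreeGroup.of (i, true))⁻¹).prod}

/-- `Hom(Γ, G)` carries the topology of pointwise convergence; `G` has the usual topology of a
group of real matrices. -/
instance homTopology {n : ℕ} {Γ : Type} [Group Γ] (G : Subgroup (GL (Fin n) ℝ)) :
    TopologicalSpace (Γ →* G) :=
  TopologicalSpace.induced (fun φ => (φ : Γ → G)) inferInstance

/-- The space `Z¹(Γ, 𝔤_{Ad ∘ φ})` of `1`-cocycles, which is the Zariski tangent space of
`Hom(Γ, G)` at `φ`. -/
abbrev cocycleSpace {n : ℕ} {Γ : Type} [Group Γ] {G : Subgroup (GL (Fin n) ℝ)} (φ : Γ →* G) :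
    Submodule ℝ (Γ → lieAlgebra G) :=
  groupCohomology.cocycles₁ (Rep.of ((adjoint G).comp φ))

/-- The virtual dimension `(1 - χ) dim G + dim R` of the space of homomorphisms to `G` from the
fundamental group of a closed orientable surface of genus `γ`, where `χ = 2 - 2γ` and `R` is the
radical of `G`, i.e. the connected subgroup whose Lie algebra is the radical of the Lie algebra of
`G`. -/
def vdim {n : ℕ} (γ : ℕ) (G : Subgroup (GL (Fin n) ℝ)) : ℤ :=
  (1 - (2 - 2 * (γ : ℤ))) * (Module.finrank ℝ (lieAlgebra G) : ℤ) +
    (Module.finrank ℝ (LieAlgebra.radical ℝ (lieAlgebra G)) : ℤ)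

/-- The set `𝒮` of smooth homomorphisms: those at which the dimension of the Zariski tangent space
is the virtual dimension. -/
def smoothLocus {n : ℕ} (γ : ℕ) (G : Subgroup (GL (Fin n) ℝ)) : Set (SurfaceGroup γ →* G) :=
  {φ | (Module.finrank ℝ (cocycleSpace φ) : ℤ) = vdim γ G}

/-- A homomorphism is flexible if smooth homomorphisms are dense in a neighborhood of it. -/
def IsFlexible {n : ℕ} {γ : ℕ} {G : Subgroup (GL (Fin n) ℝ)} (φ : SurfaceGroup γ →* G) : Prop :=
  ∃ U ∈ 𝓝 φ, U ⊆ closure (smoothLocus γ G)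

end SurfaceRep

end

noncomputable section

namespace SurfaceRep

attribute [local instance 100] LieRing.ofAssociativeRing
attribute [local instance] Matrix.linftyOpNormedRing Matrix.linftyOpNormedAlgebra

/-! ### One-parameter subgroups -/

/-! A cocycle is determined by its values on the `2γ` generators, subject to one linear equation, so
`dim Z¹ = 2γ dim 𝔤 - r`, where `r` is the rank of the linearized relator `crossedMap`. Connectedness
makes `G` act trivially on `𝔤/[𝔤,𝔤]`, and the relator is a product of commutators, so the range of
this map lies in `[𝔤,𝔤]` and `r ≤ dim 𝔤 - dim R`. Smoothness is therefore maximality of `r`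
(`mem_smoothLocus_iff`), an open condition (`isOpen_smoothLocus`); every smooth homomorphism is
flexible, and it suffices to find smooth ones near the trivial one.

Send all `bᵢ` to `1`, which leaves the `aᵢ` free, and send two of the `aᵢ` to `exp tX` and `exp tY`.
The range then contains `(Ad(exp tX) - 1)𝔤 + (Ad(exp tY) - 1)𝔤`; after division by `t` these
operators tend to `ad X` and `ad Y`, so for small `t ≠ 0` it is enough that `dim([X,𝔤] + [Y,𝔤]) ≥
dim 𝔤 - dim R`. By Killing form duality (`exists_pair_finrank`) this follows once the common
centralizer of `X` and `Y` is central, and a choice of maximal ranks provides such a pair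
(`exists_pair_centralizer`).

The input on `𝔤` is that its radical is its center and meets `[𝔤,𝔤]` trivially. Both come from
`lieIdeal_eq_bot`: an abelian ideal of nilpotent matrices exponentiates to a group whose Zariski
closure is a connected normal unipotent subgroup. Normality, like the triviality of the action on
`𝔤/[𝔤,𝔤]`, requires passing from the Lie algebra to a Zariski connected group. This is done
algebraically in `eval_eq_zero_of_stable`: functions killed at the identity together with all their
invariant derivatives vanish to infinite order there, hence near the identity by Krull's
intersection theorem, hence on all of `G`. -/

/-- The matrix exponential, with values in the general linear group. -/
def expGL {n : ℕ} (X : Matrix (Fin n) (Fin n) ℝ) : GL (Fin n) ℝ where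
  val := NormedSpace.exp X
  inv := NormedSpace.exp (-X)
  val_inv := by
    rw [← Matrix.exp_add_of_commute _ _ (Commute.refl X).neg_right, add_neg_cancel,
      NormedSpace.exp_zero]
  inv_val := by
    rw [← Matrix.exp_add_of_commute _ _ (Commute.refl X).neg_left, neg_add_cancel,
      NormedSpace.exp_zero]

lemma expGL_val {n : ℕ} (X : Matrix (Fin n) (Fin n) ℝ) :
    (expGL X : Matrix (Fin n) (Fin n) ℝ) = NormedSpace.exp X := rfl

lemma expGL_inv {n : ℕ} (X : Matrix (Fin n) (Fin n) ℝ) : (expGL X)⁻¹ = expGL (-X) := by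
  ext1; rfl

lemma expGL_zero {n : ℕ} : expGL (0 : Matrix (Fin n) (Fin n) ℝ) = 1 := by
  ext1; exact NormedSpace.exp_zero

lemma expGL_add {n : ℕ} {X Y : Matrix (Fin n) (Fin n) ℝ} (h : Commute X Y) :
    expGL (X + Y) = expGL X * expGL Y := by
  ext1; exact Matrix.exp_add_of_commute _ _ h

lemma conj_expGL {n : ℕ} (g : GL (Fin n) ℝ) (X : Matrix (Fin n) (Fin n) ℝ) :
    g * expGL X * g⁻¹ = expGL (g.1 * X * g⁻¹.1) := by
  ext1; exact (Matrix.exp_units_conj g X).symm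

lemma continuous_expGL {n : ℕ} : Continuous (expGL (n := n)) := by
  rw [Units.continuous_iff]
  refine ⟨NormedSpace.exp_continuous, ?_⟩
  exact NormedSpace.exp_continuous.comp continuous_neg

lemma hasDerivAt_exp_smul {n : ℕ} (X : Matrix (Fin n) (Fin n) ℝ) (t : ℝ) :
    HasDerivAt (fun s : ℝ => (expGL (s • X) : Matrix (Fin n) (Fin n) ℝ))
      ((expGL (t • X) : Matrix (Fin n) (Fin n) ℝ) * X) t :=
  hasDerivAt_exp_smul_const X t

/-- Polynomial functions along a curve tangent to the left invariant vector field `X`. -/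
lemma hasDerivAt_eval {n : ℕ} {X : Matrix (Fin n) (Fin n) ℝ} {c : ℝ → GL (Fin n) ℝ} {t : ℝ}
    (hc : HasDerivAt (fun s => (c s : Matrix (Fin n) (Fin n) ℝ)) ((c t).1 * X) t)
    (p : MvPolynomial (Fin n × Fin n) ℝ) :
    HasDerivAt (fun s => MvPolynomial.eval (entries (c s)) p)
      (MvPolynomial.eval (entries (c t)) (leftInv X p)) t := by
  induction p using MvPolynomial.induction_on with
  | C a => simpa [leftInv] using hasDerivAt_const t a
  | add p q hp hq =>
    simp only [map_add]
    exact hp.add hq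
  | mul_X p ij hp =>
    have h1 : HasDerivAt (fun s => (c s : Matrix (Fin n) (Fin n) ℝ) ij.1 ij.2)
        (((c t).1 * X) ij.1 ij.2) t :=
      hasDerivAt_pi.1 (hasDerivAt_pi.1 hc ij.1) ij.2
    have h2 := hp.mul h1
    simp only [map_mul, MvPolynomial.eval_X, Derivation.leibniz, map_add, smul_eq_mul]
    refine h2.congr_deriv ?_
    simp only [leftInv_X, entries, Matrix.mul_apply, map_sum, map_mul, MvPolynomial.eval_X,
      MvPolynomial.eval_C]
    ring

lemma hasDerivAt_mul_expGL {n : ℕ} (g : GL (Fin n) ℝ) (X : Matrix (Fin n) (Fin n) ℝ) (t : ℝ) :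
    HasDerivAt (fun s : ℝ => ((g * expGL (s • X) : GL (Fin n) ℝ) : Matrix (Fin n) (Fin n) ℝ))
      ((g * expGL (t • X)).1 * X) t := by
  have h := (hasDerivAt_exp_smul X t).const_mul (g : Matrix (Fin n) (Fin n) ℝ)
  rw [← mul_assoc] at h
  exact h

/-! ### Zariski closed groups contain the exponentials of their Lie algebras -/

lemma isTopologicalBasis_zariski (n : ℕ) :
    @TopologicalSpace.IsTopologicalBasis _ (zariskiTopology n)
      {U | ∃ p : MvPolynomial (Fin n × Fin n) ℝ,
        U = {g : GL (Fin n) ℝ | MvPolynomial.eval (entries g) p ≠ 0}} := by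
  let _ := zariskiTopology n
  refine ⟨?_, ?_, rfl⟩
  · rintro _ ⟨p, rfl⟩ _ ⟨q, rfl⟩ g ⟨hp, hq⟩
    refine ⟨_, ⟨p * q, rfl⟩, by simpa using ⟨hp, hq⟩, fun h hh => ?_⟩
    simpa using hh
  · rw [Set.sUnion_eq_univ_iff]
    exact fun g => ⟨_, ⟨1, rfl⟩, by simp⟩

lemma mem_of_isAlgebraic {n : ℕ} {G : Subgroup (GL (Fin n) ℝ)} (hG : IsAlgebraic G)
    {g : GL (Fin n) ℝ}
    (hg : ∀ p ∈ vanishingIdeal G, MvPolynomial.eval (entries g) p = 0) : g ∈ G := by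
  let _ := zariskiTopology n
  by_contra hgG
  obtain ⟨_, ⟨p, rfl⟩, hgp, hp⟩ :=
    (isTopologicalBasis_zariski n).exists_subset_of_mem_open (Set.mem_compl hgG)
      (isOpen_compl_iff.2 hG)
  refine hgp (hg p fun h hh => ?_)
  by_contra hne
  exact hp hne hh

/-- For `p` vanishing on `G`, the analytic function `t ↦ p(exp tX)` has as `k`-th derivative at `0`
the value at the identity of `(leftInv X)^[k] p`, which again vanishes on `G`. So the function is
identically zero. -/
lemma expGL_mem {n : ℕ} {G : Subgroup (GL (Fin n) ℝ)} (hG : IsAlgebraic G)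
    {X : Matrix (Fin n) (Fin n) ℝ} (hX : X ∈ lieAlgebra G) : expGL X ∈ G := by
  refine mem_of_isAlgebraic hG fun p hp => ?_
  have hder : ∀ (k : ℕ) (q : MvPolynomial (Fin n × Fin n) ℝ),
      iteratedDeriv k (fun t : ℝ => MvPolynomial.eval (entries (expGL (t • X))) q) =
        fun t => MvPolynomial.eval (entries (expGL (t • X))) ((leftInv X)^[k] q) := by
    intro k
    induction k with
    | zero => intro q; simp
    | succ k ih =>
      intro q
      rw [iteratedDeriv_succ', Function.iterate_succ_apply, ← ih]
      congr 1
      funext t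
      exact (hasDerivAt_eval (hasDerivAt_exp_smul X t) q).deriv
  have hmem : ∀ k : ℕ, (leftInv X)^[k] p ∈ vanishingIdeal G := by
    intro k
    induction k with
    | zero => exact hp
    | succ k ih =>
      rw [Function.iterate_succ_apply']
      exact leftInv_mem hX ih
  have han : AnalyticOnNhd ℝ (fun t : ℝ => MvPolynomial.eval (entries (expGL (t • X))) p)
      Set.univ := by
    intro t _
    have h1 : AnalyticAt ℝ (fun t : ℝ => (expGL (t • X) : Matrix (Fin n) (Fin n) ℝ)) t := by
      have : AnalyticAt ℝ (NormedSpace.exp : Matrix (Fin n) (Fin n) ℝ → _) (t • X) :=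
        NormedSpace.exp_analytic _
      exact this.comp (f := fun t : ℝ => t • X) (by fun_prop)
    refine AnalyticAt.aeval_mvPolynomial (A := ℝ) (B := ℝ) (fun ij => ?_) p
    let e : Matrix (Fin n) (Fin n) ℝ →ₗ[ℝ] ℝ := Matrix.entryLinearMap ℝ ℝ ij.1 ij.2
    exact ((LinearMap.toContinuousLinearMap e).analyticAt _).comp h1
  have hzero : (fun t : ℝ => MvPolynomial.eval (entries (expGL (t • X))) p) =ᶠ[𝓝 0] 0 := by
    have h1 := (han 0 trivial).hasFPowerSeriesAt
    have h2 : FormalMultilinearSeries.ofScalars ℝ (fun k ↦ iteratedDeriv k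
        (fun t : ℝ => MvPolynomial.eval (entries (expGL (t • X))) p) 0 / k.factorial) =
        (0 : FormalMultilinearSeries ℝ ℝ ℝ) := by
      ext k
      simp [FormalMultilinearSeries.ofScalars, hder, expGL_zero, hmem k 1 G.one_mem]
    rw [h2] at h1
    exact h1.eventually_eq_zero
  have := han.eqOn_zero_of_preconnected_of_eventuallyEq_zero isPreconnected_univ
    (Set.mem_univ 0) hzero (Set.mem_univ 1)
  simpa using this

/-! ### Functions on a connected group are determined by their derivatives at the identity -/

section infinitesimal

open MvPolynomial

variable {n : ℕ}

/-- The ideal of the identity matrix. -/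
def idealOne (n : ℕ) : Ideal (MvPolynomial (Fin n × Fin n) ℝ) :=
  RingHom.ker (eval (entries (1 : GL (Fin n) ℝ)))

lemma mem_idealOne {p : MvPolynomial (Fin n × Fin n) ℝ} :
    p ∈ idealOne n ↔ eval (entries 1) p = 0 := Iff.rfl

/-- The coordinates centered at the identity matrix. -/
def coordOne (ij : Fin n × Fin n) : MvPolynomial (Fin n × Fin n) ℝ :=
  X ij - C (entries (1 : GL (Fin n) ℝ) ij)

lemma coordOne_mem (ij : Fin n × Fin n) : coordOne ij ∈ idealOne n := by
  simp [mem_idealOne, coordOne]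

lemma taylor_one (p : MvPolynomial (Fin n × Fin n) ℝ) :
    p - C (eval (entries 1) p) - ∑ ij, C (eval (entries 1) (pderiv ij p)) * coordOne ij ∈
      idealOne n ^ 2 := by
  induction p using MvPolynomial.induction_on with
  | C a => simp
  | add p q hp hq =>
    have := Ideal.add_mem _ hp hq
    convert this using 1
    simp only [map_add, add_mul, Finset.sum_add_distrib]
    ring
  | mul_X p ij hp =>
    have h1 : (p - C (eval (entries 1) p)) * coordOne ij ∈ idealOne n ^ 2 := by
      rw [pow_two]
      exact Ideal.mul_mem_mul (by simp [mem_idealOne]) (coordOne_mem ij)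
    have h2 := Ideal.add_mem _ h1 (Ideal.mul_mem_left _ (C (entries (1 : GL (Fin n) ℝ) ij)) hp)
    convert h2 using 1
    have h3 : ∑ kl, C (eval (entries 1) (pderiv kl (p * X ij))) * coordOne kl =
        C (entries (1 : GL (Fin n) ℝ) ij) *
          ∑ kl, C (eval (entries 1) (pderiv kl p)) * coordOne kl +
        C (eval (entries 1) p) * coordOne ij := by
      have h4 : ∀ kl : Fin n × Fin n, C (eval (entries 1) (pderiv kl (p * X ij))) * coordOne kl =
          C (entries (1 : GL (Fin n) ℝ) ij) *
            (C (eval (entries 1) (pderiv kl p)) * coordOne kl) +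
          if kl = ij then C (eval (entries 1) p) * coordOne ij else 0 := by
        intro kl
        rw [Derivation.leibniz, pderiv_X]
        split_ifs with h
        · subst h
          simp
          ring
        · rw [Pi.single_eq_of_ne (Ne.symm h)]
          simp
          ring
      rw [Finset.sum_congr rfl fun kl _ => h4 kl, Finset.sum_add_distrib, ← Finset.mul_sum]
      simp
    rw [h3]
    simp only [map_mul, eval_X, coordOne]
    ring

/-- The differential at the identity. -/
def diffOne (n : ℕ) :
    MvPolynomial (Fin n × Fin n) ℝ →ₗ[ℝ] Module.Dual ℝ (Matrix (Fin n) (Fin n) ℝ) where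
  toFun p :=
    { toFun := fun X => derivAtOne X p
      map_add' := fun X Y => by simp [derivAtOne, add_mul, Finset.sum_add_distrib]
      map_smul' := fun c X => by simp [derivAtOne, mul_assoc, Finset.mul_sum] }
  map_add' p q := by
    ext X
    simp [derivAtOne, mul_add, Finset.sum_add_distrib]
  map_smul' c p := by
    ext X
    simp [derivAtOne, Finset.mul_sum, mul_left_comm]

lemma diffOne_apply (p : MvPolynomial (Fin n × Fin n) ℝ) (X : Matrix (Fin n) (Fin n) ℝ) :
    diffOne n p X = derivAtOne X p := rfl

lemma derivAtOne_coordOne (X : Matrix (Fin n) (Fin n) ℝ) (ij : Fin n × Fin n) :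
    derivAtOne X (coordOne ij) = X ij.1 ij.2 := by
  rw [← eval_one_leftInv, coordOne, map_sub, leftInv_X, derivation_C, sub_zero]
  simp [entries, Matrix.one_apply]

lemma mem_sq_of_diffOne_eq_zero {p : MvPolynomial (Fin n × Fin n) ℝ} (hp : p ∈ idealOne n)
    (hd : diffOne n p = 0) : p ∈ idealOne n ^ 2 := by
  have h := taylor_one p
  have h1 : ∀ ij : Fin n × Fin n, eval (entries 1) (pderiv ij p) = 0 := by
    intro ij
    have h2 := LinearMap.congr_fun hd (Matrix.single ij.1 ij.2 1)
    rw [diffOne_apply, derivAtOne, Finset.sum_eq_single ij] at h2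
    · simpa using h2
    · intro kl _ hkl
      rw [Matrix.single_apply_of_ne, zero_mul]
      rintro ⟨h3, h4⟩
      exact hkl (Prod.ext h3.symm h4.symm)
    · simp
  simpa [h1, mem_idealOne.1 hp] using h

/-- The `b i` form a basis of `𝔤` and the `x i` are functions whose differentials extend the dual
basis: local coordinates on `G` at the identity, modulo second order and modulo functions vanishing
on `G`. -/
lemma exists_coordinates (G : Subgroup (GL (Fin n) ℝ)) :
    ∃ (d : ℕ) (b : Fin d → Matrix (Fin n) (Fin n) ℝ)
      (x : Fin d → MvPolynomial (Fin n × Fin n) ℝ),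
      (∀ i, b i ∈ lieAlgebra G) ∧ (∀ i, x i ∈ idealOne n) ∧
      ∀ y ∈ idealOne n, y - ∑ i, C (derivAtOne (b i) y) * x i ∈
        idealOne n ^ 2 ⊔ vanishingIdeal G := by
  let W : Submodule ℝ (Matrix (Fin n) (Fin n) ℝ) := (lieAlgebra G).toSubmodule
  let b := Module.finBasis ℝ W
  have hext : ∀ i, ∃ l : Matrix (Fin n) (Fin n) ℝ →ₗ[ℝ] ℝ, l ∘ₗ W.subtype = b.coord i :=
    fun i => LinearMap.exists_extend _
  choose l hl using hext
  let x : Fin (Module.finrank ℝ W) → MvPolynomial (Fin n × Fin n) ℝ := fun i =>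
    ∑ ij, C (l i (Matrix.single ij.1 ij.2 1)) * coordOne ij
  have hx : ∀ i, diffOne n (x i) = l i := by
    intro i
    ext X
    have h1 : X = ∑ ij : Fin n × Fin n, X ij.1 ij.2 • Matrix.single ij.1 ij.2 (1 : ℝ) := by
      conv_lhs => rw [Matrix.matrix_eq_sum_single X]
      rw [Fintype.sum_prod_type]
      simp
    conv_rhs => rw [h1]
    simp only [x, map_sum, LinearMap.sum_apply, map_smul, smul_eq_mul]
    refine Finset.sum_congr rfl fun ij _ => ?_
    rw [C_mul', map_smul, LinearMap.smul_apply, diffOne_apply, derivAtOne_coordOne, smul_eq_mul,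
      mul_comm]
  refine ⟨_, fun i => (b i : W).1, x, fun i => (b i).2, fun i => ?_, fun y hy => ?_⟩
  · exact Ideal.sum_mem _ fun ij _ => Ideal.mul_mem_left _ _ (coordOne_mem ij)
  · set y' := y - ∑ i, C (derivAtOne (b i : W).1 y) * x i with hy'
    have hy'M : y' ∈ idealOne n := Ideal.sub_mem _ hy (Ideal.sum_mem _ fun i _ =>
      Ideal.mul_mem_left _ _ (Ideal.sum_mem _ fun ij _ =>
        Ideal.mul_mem_left _ _ (coordOne_mem ij)))
    -- `𝔤` is by definition the common kernel of the differentials in `N`, so by double annihilators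
    -- a differential that vanishes on `𝔤` is that of some function in the vanishing ideal.
    let N : Submodule ℝ (Module.Dual ℝ (Matrix (Fin n) (Fin n) ℝ)) :=
      ((vanishingIdeal G).restrictScalars ℝ).map (diffOne n)
    have hWN : N.dualCoannihilator ≤ W := by
      intro X hX p hp
      rw [Submodule.mem_dualCoannihilator] at hX
      exact hX _ ⟨p, hp, rfl⟩
    have hann : diffOne n y' ∈ W.dualAnnihilator := by
      rw [Submodule.mem_dualAnnihilator]
      have h1 : (diffOne n y') ∘ₗ W.subtype = 0 := by
        refine b.ext fun j => ?_
        have h2 : ∀ i, l i (b j : W).1 = if j = i then 1 else 0 := by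
          intro i
          have := LinearMap.congr_fun (hl i) (b j)
          simpa [Finsupp.single_apply] using this
        simp only [LinearMap.comp_apply, Submodule.subtype_apply, LinearMap.zero_apply, hy',
          map_sub, map_sum, C_mul', map_smul, hx, LinearMap.sub_apply, LinearMap.sum_apply,
          LinearMap.smul_apply, h2, diffOne_apply]
        simp
      exact fun w hw => LinearMap.congr_fun h1 ⟨w, hw⟩
    have hN : diffOne n y' ∈ N := by
      rw [← Subspace.dualCoannihilator_dualAnnihilator_eq (W := N)]
      exact Submodule.dualAnnihilator_anti hWN hann
    obtain ⟨q, hq, hqy⟩ := hN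
    have hq : q ∈ vanishingIdeal G := hq
    have h1 : y' - q ∈ idealOne n ^ 2 := by
      refine mem_sq_of_diffOne_eq_zero (Ideal.sub_mem _ hy'M (hq 1 G.one_mem)) ?_
      rw [map_sub, hqy, sub_self]
    have h2 := Ideal.add_mem _ (Ideal.mem_sup_left (T := vanishingIdeal G) h1)
      (Ideal.mem_sup_right hq)
    rwa [sub_add_cancel] at h2

lemma mul_mem_pow_sup {R : Type*} [CommRing R] {M I : Ideal R} {i j : ℕ} {a b : R}
    (ha : a ∈ M ^ i) (hb : b ∈ M ^ j ⊔ I) : a * b ∈ M ^ (i + j) ⊔ I := by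
  obtain ⟨p, hp, q, hq, rfl⟩ := Submodule.mem_sup.1 hb
  rw [mul_add, pow_add]
  exact Ideal.add_mem _ (Ideal.mem_sup_left (Ideal.mul_mem_mul ha hp))
    (Ideal.mem_sup_right (Ideal.mul_mem_left _ _ hq))

/-- The Euler operator acts by `k` on the functions vanishing to order `k`. -/
lemma euler_sub_mem {G : Subgroup (GL (Fin n) ℝ)}
    {E : Derivation ℝ (MvPolynomial (Fin n × Fin n) ℝ) (MvPolynomial (Fin n × Fin n) ℝ)}
    (h0 : ∀ f, E f ∈ idealOne n)
    (h1 : ∀ f ∈ idealOne n, E f - f ∈ idealOne n ^ 2 ⊔ vanishingIdeal G) (k : ℕ) :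
    ∀ f ∈ idealOne n ^ k, E f - C (k : ℝ) * f ∈ idealOne n ^ (k + 1) ⊔ vanishingIdeal G := by
  induction k with
  | zero =>
    intro f _
    simpa using Ideal.mem_sup_left (h0 f)
  | succ k ih =>
    intro f hf
    rw [pow_succ] at hf
    refine Submodule.mul_induction_on hf (fun a ha b hb => ?_) fun p q hp hq => ?_
    · have h2 : E (a * b) - C ((k + 1 : ℕ) : ℝ) * (a * b) =
          a * (E b - b) + b * (E a - C (k : ℝ) * a) := by
        rw [Derivation.leibniz]
        simp only [smul_eq_mul, Nat.cast_add, Nat.cast_one, map_add, map_one]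
        ring
      rw [h2]
      have h4 := mul_mem_pow_sup ha (h1 b hb)
      refine Ideal.add_mem _ h4 ?_
      have h3 := mul_mem_pow_sup ((pow_one (idealOne n)).symm ▸ hb) (ih a ha)
      rwa [add_comm 1] at h3
    · have := Ideal.add_mem _ hp hq
      have h2 : E (p + q) - C ((k + 1 : ℕ) : ℝ) * (p + q) =
          E p - C ((k + 1 : ℕ) : ℝ) * p + (E q - C ((k + 1 : ℕ) : ℝ) * q) := by
        rw [map_add, mul_add]
        abel
      rwa [h2]

/-- A family of functions on `G` which is stable under left invariant derivations and vanishes at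
the identity vanishes there to infinite order. -/
lemma mem_pow_sup_of_stable {G : Subgroup (GL (Fin n) ℝ)} {E : Type*} [AddCommGroup E] [Module ℝ E]
    (F : E →ₗ[ℝ] MvPolynomial (Fin n × Fin n) ℝ)
    (hF : ∀ X ∈ lieAlgebra G, ∀ w, ∃ w', leftInv X (F w) - F w' ∈ vanishingIdeal G)
    (h0 : ∀ w, eval (entries 1) (F w) = 0) (k : ℕ) (w : E) :
    F w ∈ idealOne n ^ k ⊔ vanishingIdeal G := by
  obtain ⟨d, b, x, hb, hx, hy⟩ := exists_coordinates G
  -- The Euler field in the coordinates `x i`. On a member of the family it gains an order of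
  -- vanishing by stability, yet it multiplies the leading term of order `k` by `k`; so this term is
  -- zero.
  let D : Derivation ℝ (MvPolynomial (Fin n × Fin n) ℝ) (MvPolynomial (Fin n × Fin n) ℝ) :=
    ∑ i, x i • leftInv (b i)
  have hD : ∀ f, D f = ∑ i, x i * leftInv (b i) f := fun f => by
    have h1 : (D : MvPolynomial (Fin n × Fin n) ℝ → MvPolynomial (Fin n × Fin n) ℝ) =
        ∑ i, ⇑(x i • leftInv (b i)) :=
      map_sum (Derivation.coeFnAddMonoidHom (R := ℝ)) (fun i => x i • leftInv (b i)) _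
    rw [h1, Finset.sum_apply]
    rfl
  have hD0 : ∀ f, D f ∈ idealOne n := fun f => by
    rw [hD]
    exact Ideal.sum_mem _ fun i _ => Ideal.mul_mem_right _ _ (hx i)
  have hD1 : ∀ f ∈ idealOne n, D f - f ∈ idealOne n ^ 2 ⊔ vanishingIdeal G := by
    intro f hf
    have h1 : D f - f = ∑ i, x i * (leftInv (b i) f - C (derivAtOne (b i) f)) -
        (f - ∑ i, C (derivAtOne (b i) f) * x i) := by
      rw [hD]
      simp only [mul_sub, Finset.sum_sub_distrib, mul_comm (x _) (C _)]
      ring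
    rw [h1]
    refine Ideal.sub_mem _ (Ideal.sum_mem _ fun i _ => Ideal.mem_sup_left ?_) (hy f hf)
    rw [pow_two]
    refine Ideal.mul_mem_mul (hx i) ?_
    rw [mem_idealOne, map_sub, eval_one_leftInv, eval_C, sub_self]
  have hDI : ∀ f ∈ vanishingIdeal G, D f ∈ vanishingIdeal G := by
    intro f hf
    rw [hD]
    exact Ideal.sum_mem _ fun i _ => Ideal.mul_mem_left _ _ (leftInv_mem (hb i) hf)
  induction k generalizing w with
  | zero => simp
  | succ k ih =>
    -- Order one is the hypothesis `h0`; it is separated because the general step divides by `k`.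
    rcases Nat.eq_zero_or_pos k with rfl | hk
    · simpa using Ideal.mem_sup_left (h0 w)
    obtain ⟨p, hp, q, hq, hpq⟩ := Submodule.mem_sup.1 (ih w)
    have h1 : D (F w) - C (k : ℝ) * F w ∈ idealOne n ^ (k + 1) ⊔ vanishingIdeal G := by
      have h2 := Ideal.add_mem _ (euler_sub_mem hD0 hD1 k p hp) (Ideal.mem_sup_right
        (Ideal.sub_mem _ (hDI q hq) (Ideal.mul_mem_left _ (C (k : ℝ)) hq)))
      convert h2 using 1
      rw [← hpq, map_add]
      ring
    have h2 : D (F w) ∈ idealOne n ^ (k + 1) ⊔ vanishingIdeal G := by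
      rw [hD]
      refine Ideal.sum_mem _ fun i _ => ?_
      obtain ⟨w', hw'⟩ := hF (b i) (hb i) w
      have h3 : leftInv (b i) (F w) ∈ idealOne n ^ k ⊔ vanishingIdeal G := by
        have := Ideal.add_mem _ (Ideal.mem_sup_right hw') (ih w')
        rwa [sub_add_cancel] at this
      have h4 := mul_mem_pow_sup ((pow_one (idealOne n)).symm ▸ hx i) h3
      rwa [add_comm 1] at h4
    have h3 := Ideal.mul_mem_left _ (C (k : ℝ)⁻¹) (Ideal.sub_mem _ h2 h1)
    rwa [sub_sub_cancel, ← mul_assoc, ← C_mul, inv_mul_cancel₀ (by positivity), C_1,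
      one_mul] at h3

/-- Krull's intersection theorem in the coordinate ring of `G`: an element of all powers of the
ideal of the identity is fixed by some `r` in that ideal, and `u = 1 - r` works. -/
lemma exists_mul_eq_zero_of_stable {G : Subgroup (GL (Fin n) ℝ)} {E : Type*} [AddCommGroup E]
    [Module ℝ E] (F : E →ₗ[ℝ] MvPolynomial (Fin n × Fin n) ℝ)
    (hF : ∀ X ∈ lieAlgebra G, ∀ w, ∃ w', leftInv X (F w) - F w' ∈ vanishingIdeal G)
    (h0 : ∀ w, eval (entries 1) (F w) = 0) (w : E) :
    ∃ u : MvPolynomial (Fin n × Fin n) ℝ, eval (entries 1) u ≠ 0 ∧ u * F w ∈ vanishingIdeal G := by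
  have h1 : (Ideal.Quotient.mk (vanishingIdeal G) (F w)) ∈
      (⨅ i : ℕ, idealOne n ^ i • ⊤ : Submodule (MvPolynomial (Fin n × Fin n) ℝ)
        (MvPolynomial (Fin n × Fin n) ℝ ⧸ vanishingIdeal G)) := by
    rw [Submodule.mem_iInf]
    intro k
    obtain ⟨p, hp, q, hq, hpq⟩ := Submodule.mem_sup.1 (mem_pow_sup_of_stable F hF h0 k w)
    have h2 : Ideal.Quotient.mk (vanishingIdeal G) (F w) =
        p • (1 : MvPolynomial (Fin n × Fin n) ℝ ⧸ vanishingIdeal G) := by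
      have h3 : p • (1 : MvPolynomial (Fin n × Fin n) ℝ ⧸ vanishingIdeal G) =
        Ideal.Quotient.mk (vanishingIdeal G) (p * 1) := rfl
      rw [← hpq, map_add, Ideal.Quotient.eq_zero_iff_mem.2 hq, add_zero, h3, mul_one]
    rw [h2]
    exact Submodule.smul_mem_smul hp trivial
  obtain ⟨⟨r, hr⟩, hr1⟩ := (Ideal.mem_iInf_smul_pow_eq_bot_iff _ _).1 h1
  refine ⟨1 - r, by simp [mem_idealOne.1 hr], ?_⟩
  rw [← Ideal.Quotient.eq_zero_iff_mem, sub_mul, one_mul, map_sub, sub_eq_zero]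
  exact hr1.symm

/-- A finite dimensional family of functions on a connected group `G` which is stable under left
invariant derivations and vanishes at the identity vanishes on `G`. -/
theorem eval_eq_zero_of_stable {G : Subgroup (GL (Fin n) ℝ)} (hconn : IsZariskiConnected G)
    {E : Type*} [AddCommGroup E] [Module ℝ E] [FiniteDimensional ℝ E]
    (F : E →ₗ[ℝ] MvPolynomial (Fin n × Fin n) ℝ)
    (hF : ∀ X ∈ lieAlgebra G, ∀ w, ∃ w', leftInv X (F w) - F w' ∈ vanishingIdeal G)
    (h0 : ∀ w, eval (entries 1) (F w) = 0) {g : GL (Fin n) ℝ} (hg : g ∈ G) (w : E) :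
    eval (entries g) (F w) = 0 := by
  let _ := zariskiTopology n
  have hopen : ∀ p : MvPolynomial (Fin n × Fin n) ℝ,
      IsOpen {h : GL (Fin n) ℝ | eval (entries h) p ≠ 0} := fun p =>
    TopologicalSpace.isOpen_generateFrom_of_mem ⟨p, rfl⟩
  let A : Set (GL (Fin n) ℝ) := {h | ∃ w, eval (entries h) (F w) ≠ 0}
  have hA : IsOpen A := by
    have : A = ⋃ w, {h | eval (entries h) (F w) ≠ 0} := by ext; simp [A]
    rw [this]
    exact isOpen_iUnion fun w => hopen _
  -- The common zero set is open in `G` as well. Left translation moves a zero `h` to the identity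
  -- and commutes with `leftInv`; finite dimensionality of `E` leaves finitely many functions `u` to
  -- intersect over.
  have hloc : ∀ h ∈ G, h ∉ A → ∃ U, IsOpen U ∧ h ∈ U ∧ ∀ k ∈ G, k ∈ U → k ∉ A := by
    intro h hh hhA
    have hhA' : ∀ w, eval (entries h) (F w) = 0 := fun w => by
      by_contra hne
      exact hhA ⟨w, hne⟩
    have hloc1 := exists_mul_eq_zero_of_stable (G := G) ((leftTrans h).toLinearMap ∘ₗ F) (by
      intro X hX w
      obtain ⟨w', hw'⟩ := hF X hX w
      refine ⟨w', fun k hk => ?_⟩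
      have := hw' (h * k) (G.mul_mem hh hk)
      rwa [← eval_leftTrans, map_sub, leftTrans_leftInv] at this) (by
      intro w
      have : eval (entries 1) (leftTrans h (F w)) = 0 := by
        rw [eval_leftTrans, mul_one, hhA']
      exact this)
    choose u hu1 hu2 using hloc1
    let b := Module.finBasis ℝ E
    refine ⟨⋂ i, {k | eval (entries k) (leftTrans h⁻¹ (u (b i))) ≠ 0},
      isOpen_iInter_of_finite fun i => hopen _, ?_, ?_⟩
    · simp only [Set.mem_iInter, Set.mem_ofPred_eq, eval_leftTrans, inv_mul_cancel]
      exact fun i => hu1 _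
    · rintro k hk hkU ⟨w, hw⟩
      simp only [Set.mem_iInter, Set.mem_ofPred_eq, eval_leftTrans] at hkU
      have hb : ∀ i, eval (entries k) (F (b i)) = 0 := by
        intro i
        have h1 := hu2 (b i) (h⁻¹ * k) (G.mul_mem (G.inv_mem hh) hk)
        rw [map_mul] at h1
        have h2 := (mul_eq_zero.1 h1).resolve_left (hkU i)
        rw [LinearMap.comp_apply, AlgHom.toLinearMap_apply, eval_leftTrans,
          mul_inv_cancel_left] at h2
        exact h2
      have hlin : (aeval (entries k)).toLinearMap ∘ₗ F = 0 := b.ext fun i => by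
        simpa [aeval_eq_eval] using hb i
      refine hw ?_
      have := LinearMap.congr_fun hlin w
      simpa [aeval_eq_eval] using this
  choose! U hUo hUm hU using hloc
  by_contra hne
  have hpre := hconn.2 A (⋃ h ∈ (G : Set (GL (Fin n) ℝ)) \ A, U h) hA
    (isOpen_biUnion fun h hh => hUo h hh.1 hh.2) (by
      intro h hh
      by_cases hhA : h ∈ A
      · exact Or.inl hhA
      · exact Or.inr (Set.mem_biUnion ⟨hh, hhA⟩ (hUm h hh hhA)))
    ⟨g, hg, w, hne⟩
    ⟨1, G.one_mem, Set.mem_biUnion (x := 1) ⟨G.one_mem, fun ⟨w, hw⟩ => hw (h0 w)⟩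
      (hUm 1 G.one_mem fun ⟨w, hw⟩ => hw (h0 w))⟩
  obtain ⟨k, hkG, hkA, hkU⟩ := hpre
  simp only [Set.mem_iUnion] at hkU
  obtain ⟨h, hh, hk⟩ := hkU
  exact hU h hh.1 hh.2 k hkG hk hkA

end infinitesimal

/-! ### The adjoint action of a connected group -/

section conjugation

variable {n : ℕ}

/-- The generic conjugate `g w adj(g)` of the matrix `w`. -/
def genericConj (w : Matrix (Fin n) (Fin n) ℝ) :
    Matrix (Fin n) (Fin n) (MvPolynomial (Fin n × Fin n) ℝ) :=
  Matrix.mvPolynomialX (Fin n) (Fin n) ℝ *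
    (w.map MvPolynomial.C : Matrix (Fin n) (Fin n) (MvPolynomial (Fin n × Fin n) ℝ)) *
    (Matrix.mvPolynomialX (Fin n) (Fin n) ℝ).adjugate

lemma genericConj_add (v w : Matrix (Fin n) (Fin n) ℝ) :
    genericConj (v + w) = genericConj v + genericConj w := by
  have h : ((v + w).map MvPolynomial.C : Matrix (Fin n) (Fin n) (MvPolynomial (Fin n × Fin n) ℝ)) =
      v.map MvPolynomial.C + w.map MvPolynomial.C :=
    Matrix.map_add _ (map_add _) v w
  rw [genericConj, h, mul_add, add_mul]
  rfl

lemma genericConj_smul (c : ℝ) (w : Matrix (Fin n) (Fin n) ℝ) :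
    genericConj (c • w) = c • genericConj w := by
  have h : ((c • w).map MvPolynomial.C : Matrix (Fin n) (Fin n) (MvPolynomial (Fin n × Fin n) ℝ)) =
      c • w.map MvPolynomial.C := by
    ext1 i j
    simp [MvPolynomial.smul_eq_C_mul]
  rw [genericConj, h, Matrix.mul_smul, Matrix.smul_mul]
  rfl

/-- The polynomial function `g ↦ ℓ (g w adj(g)) - ℓ w det g`, linearly in `w`. -/
def conjPoly (ℓ : Matrix (Fin n) (Fin n) ℝ →ₗ[ℝ] ℝ) :
    Matrix (Fin n) (Fin n) ℝ →ₗ[ℝ] MvPolynomial (Fin n × Fin n) ℝ where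
  toFun w := ∑ ij : Fin n × Fin n, ℓ (Matrix.single ij.1 ij.2 1) •
      genericConj w ij.1 ij.2 -
    ℓ w • (Matrix.mvPolynomialX (Fin n) (Fin n) ℝ).det
  map_add' v w := by
    simp only [genericConj_add, Matrix.add_apply, smul_add, Finset.sum_add_distrib, map_add,
      add_smul]
    abel
  map_smul' c w := by
    simp only [genericConj_smul, Matrix.smul_apply, map_smul, smul_eq_mul, RingHom.id_apply,
      smul_sub, Finset.smul_sum, mul_smul]
    simp only [smul_comm c]

lemma map_eval_mvPolynomialX (g : GL (Fin n) ℝ) :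
    (Matrix.mvPolynomialX (Fin n) (Fin n) ℝ).map (MvPolynomial.eval (entries g)) = g.1 := by
  ext i j
  simp [entries]

lemma eval_det (g : GL (Fin n) ℝ) :
    MvPolynomial.eval (entries g) (Matrix.mvPolynomialX (Fin n) (Fin n) ℝ).det = g.1.det := by
  rw [RingHom.map_det, RingHom.mapMatrix_apply, map_eval_mvPolynomialX]

lemma eval_conjPoly (ℓ : Matrix (Fin n) (Fin n) ℝ →ₗ[ℝ] ℝ) (w : Matrix (Fin n) (Fin n) ℝ)
    (g : GL (Fin n) ℝ) :
    MvPolynomial.eval (entries g) (conjPoly ℓ w) =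
      g.1.det * (ℓ (g.1 * w * g⁻¹.1) - ℓ w) := by
  have h1 : (genericConj w).map (MvPolynomial.eval (entries g)) =
      g.1.det • (g.1 * w * g⁻¹.1) := by
    have h2 : g.1.adjugate = g.1.det • g⁻¹.1 := by
      have h3 : g.1.adjugate * g.1 * g⁻¹.1 = g.1.det • g⁻¹.1 := by
        rw [Matrix.adjugate_mul, Matrix.smul_mul, one_mul]
      rwa [mul_assoc, ← Units.val_mul, mul_inv_cancel, Units.val_one, mul_one] at h3
    have h4 := (MvPolynomial.eval (entries g)).map_adjugate (Matrix.mvPolynomialX (Fin n) (Fin n) ℝ)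
    simp only [RingHom.mapMatrix_apply] at h4
    rw [genericConj, Matrix.map_mul, Matrix.map_mul, map_eval_mvPolynomialX, h4,
      map_eval_mvPolynomialX, h2, Matrix.mul_smul]
    congr 3
    ext i j
    simp
  have h5 : ∀ A : Matrix (Fin n) (Fin n) ℝ,
      ∑ ij : Fin n × Fin n, ℓ (Matrix.single ij.1 ij.2 1) * A ij.1 ij.2 = ℓ A := by
    intro A
    conv_rhs => rw [Matrix.matrix_eq_sum_single A]
    rw [Fintype.sum_prod_type, map_sum]
    refine Finset.sum_congr rfl fun i _ => ?_
    rw [map_sum]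
    refine Finset.sum_congr rfl fun j _ => ?_
    have : Matrix.single i j (A i j) = A i j • Matrix.single i j (1 : ℝ) := by simp
    rw [this, map_smul, smul_eq_mul, mul_comm]
  have h6 : ∀ ij : Fin n × Fin n, MvPolynomial.eval (entries g)
      (genericConj w ij.1 ij.2) =
      (g.1.det • (g.1 * w * g⁻¹.1)) ij.1 ij.2 := fun ij => by rw [← h1]; rfl
  change MvPolynomial.eval (entries g) (_ - _) = _
  rw [map_sub, map_sum]
  simp only [MvPolynomial.smul_eval, h6, h5, eval_det, map_smul, smul_eq_mul]
  ring

lemma hasDerivAt_conj (g : GL (Fin n) ℝ) (X w : Matrix (Fin n) (Fin n) ℝ) :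
    HasDerivAt (fun t : ℝ => (g * expGL (t • X)).1 * w * ((g * expGL (t • X))⁻¹).1)
      (g.1 * ⁅X, w⁆ * g⁻¹.1) 0 := by
  have h1 := hasDerivAt_mul_expGL g X 0
  have h2 := (hasDerivAt_exp_smul (-X) 0).mul_const g⁻¹.1
  have h3 := (h1.mul_const w).mul h2
  have h4 : (fun t : ℝ => (g * expGL (t • X)).1 * w * ((g * expGL (t • X))⁻¹).1) =
      fun t : ℝ => (g * expGL (t • X)).1 * w * ((expGL (t • -X)).1 * g⁻¹.1) := by
    funext t
    rw [mul_inv_rev, expGL_inv, Units.val_mul (expGL _), smul_neg]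
  rw [h4]
  refine h3.congr_deriv ?_
  simp only [zero_smul, expGL_zero, mul_one, Units.val_one, one_mul, Ring.lie_def]
  noncomm_ring

/-- Let `W' ≤ W` be spaces of matrices such that `𝔤` maps `W` to `W'`. If `G` is connected then it
acts trivially on `W / W'`. -/
theorem conj_sub_mem {G : Subgroup (GL (Fin n) ℝ)} (hconn : IsZariskiConnected G)
    {W W' : Submodule ℝ (Matrix (Fin n) (Fin n) ℝ)} (hW : W' ≤ W)
    (hlie : ∀ X ∈ lieAlgebra G, ∀ w ∈ W, ⁅X, w⁆ ∈ W') {g : GL (Fin n) ℝ} (hg : g ∈ G)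
    {w : Matrix (Fin n) (Fin n) ℝ} (hw : w ∈ W) : g.1 * w * g⁻¹.1 - w ∈ W' := by
  rw [← Subspace.forall_mem_dualAnnihilator_apply_eq_zero_iff W']
  intro ℓ hℓ
  rw [Submodule.mem_dualAnnihilator] at hℓ
  have h := eval_eq_zero_of_stable hconn (conjPoly ℓ ∘ₗ W.subtype) ?_ ?_ hg ⟨w, hw⟩
  · rw [LinearMap.comp_apply, eval_conjPoly, Submodule.subtype_apply] at h
    rw [map_sub]
    have hdet : g.1.det ≠ 0 := ((Matrix.isUnit_iff_isUnit_det _).1 g.isUnit).ne_zero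
    exact (mul_eq_zero.1 h).resolve_left hdet
  · rintro X hX ⟨v, hv⟩
    -- The factor `det g` that makes `conjPoly` polynomial has logarithmic derivative `δ` along `X`.
    -- The derivative of `conjPoly ℓ v` is thus `conjPoly ℓ` of `⁅X, v⁆ + δ • v`, since `ℓ` kills
    -- `⁅X, v⁆ ∈ W'`.
    set δ := MvPolynomial.eval (entries (1 : GL (Fin n) ℝ))
      (leftInv X (Matrix.mvPolynomialX (Fin n) (Fin n) ℝ).det) with hδ
    refine ⟨⟨⁅X, v⁆ + δ • v, W.add_mem (hW (hlie X hX v hv)) (W.smul_mem _ hv)⟩, fun k _ => ?_⟩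
    have h1 := hasDerivAt_eval (hasDerivAt_mul_expGL k X 0) (conjPoly ℓ v)
    have h2 := hasDerivAt_eval (hasDerivAt_mul_expGL 1 X 0)
      (Matrix.mvPolynomialX (Fin n) (Fin n) ℝ).det
    have h3 := ((LinearMap.toContinuousLinearMap ℓ).hasFDerivAt.comp_hasDerivAt (0 : ℝ)
      (hasDerivAt_conj k X v)).sub_const (ℓ v)
    have h4 := (h2.const_mul k.1.det).mul h3
    simp only [zero_smul, expGL_zero, mul_one] at h1 h2 h4
    have h5 : (fun s : ℝ => MvPolynomial.eval (entries (k * expGL (s • X))) (conjPoly ℓ v)) =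
        fun s : ℝ => (k.1.det * MvPolynomial.eval (entries (1 * expGL (s • X)))
          (Matrix.mvPolynomialX (Fin n) (Fin n) ℝ).det) *
          (ℓ ((k * expGL (s • X)).1 * v * ((k * expGL (s • X))⁻¹).1) - ℓ v) := by
      funext s
      rw [eval_conjPoly, eval_det, one_mul, Units.val_mul, Matrix.det_mul]
    rw [h5] at h1
    have h6 : _ = k.1.det * δ * (ℓ ((k * expGL ((0 : ℝ) • X)).1 * v *
        ((k * expGL ((0 : ℝ) • X))⁻¹).1) - ℓ v) +
        k.1.det * MvPolynomial.eval (entries (1 : GL (Fin n) ℝ))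
          (Matrix.mvPolynomialX (Fin n) (Fin n) ℝ).det * ℓ (k.1 * ⁅X, v⁆ * k⁻¹.1) :=
      h1.unique h4
    simp only [LinearMap.comp_apply, Submodule.subtype_apply, map_sub, map_add, map_smul,
      eval_conjPoly, MvPolynomial.smul_eval, hℓ _ (hlie X hX v hv)]
    rw [h6]
    simp [eval_det, expGL_zero]
    ring
  · intro v
    rw [LinearMap.comp_apply, eval_conjPoly]
    simp

end conjugation

/-! ### Nilpotent matrices -/

/-- The projection onto the part where `A` is invertible is a polynomial in `A` without constant
term. Its trace vanishes, so the idempotent itself does, in characteristic zero. -/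
lemma isNilpotent_of_trace_pow_eq_zero {n : ℕ} {A : Matrix (Fin n) (Fin n) ℝ}
    (h : ∀ k : ℕ, (A ^ (k + 1)).trace = 0) : IsNilpotent A := by
  open Polynomial in
  have htr : ∀ p : ℝ[X], (aeval A (X * p)).trace = 0 := by
    intro p
    induction p using Polynomial.induction_on' with
    | add p q hp hq => rw [mul_add, map_add, Matrix.trace_add, hp, hq, add_zero]
    | monomial k a =>
      rw [← C_mul_X_pow_eq_monomial, mul_left_comm, ← pow_succ', map_mul, aeval_C, map_pow,
        aeval_X, ← Algebra.smul_def, Matrix.trace_smul, h, smul_zero]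
  obtain ⟨q, hq, hdvd⟩ := (minpoly ℝ A).exists_eq_pow_rootMultiplicity_mul_and_not_dvd
    (minpoly.ne_zero (Algebra.IsIntegral.isIntegral A)) 0
  set a := (minpoly ℝ A).rootMultiplicity 0
  rw [C_0, sub_zero] at hq hdvd
  -- The exponent `a + 1` rather than `a` makes `e` divisible by `A` even when `a = 0`.
  have hcop : IsCoprime (X ^ (a + 1)) q :=
    ((Polynomial.irreducible_X.coprime_iff_not_dvd).2 hdvd).pow_left
  obtain ⟨u, v, huv⟩ := hcop
  have h0 : aeval A (X ^ a * q) = 0 := hq ▸ minpoly.aeval ℝ A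
  set e := aeval A (u * X ^ (a + 1)) with he
  have hidem : IsIdempotentElem e := by
    have h1 : u * X ^ (a + 1) * (u * X ^ (a + 1)) = u * X ^ (a + 1) - u * X * v * (X ^ a * q) := by
      linear_combination (u * X ^ (a + 1)) * huv
    rw [IsIdempotentElem, he, ← map_mul, h1, map_sub, map_mul _ _ (X ^ a * q), h0, mul_zero,
      sub_zero]
  have he0 : e = 0 := by
    have h1 : IsIdempotentElem (Matrix.toLin' e) := by
      rw [IsIdempotentElem, Module.End.mul_eq_comp, ← Matrix.toLin'_mul, hidem.eq]
    have h2 : LinearMap.trace ℝ _ (Matrix.toLin' e) = 0 := by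
      rw [Matrix.trace_toLin'_eq, he, show u * X ^ (a + 1) = X * (u * X ^ a) by ring, htr]
    have h3 := LinearMap.IsIdempotentElem.eq_zero_of_trace_eq_zero h1 h2
    exact (LinearEquiv.map_eq_zero_iff _).1 h3
  refine ⟨a, ?_⟩
  have h1 : (X : ℝ[X]) ^ a = u * X ^ (a + 1) * X ^ a + v * (X ^ a * q) := by
    linear_combination (-X ^ a) * huv
  have h2 := congrArg (aeval A) h1
  rw [map_add, map_mul, ← he, he0, zero_mul, zero_add, map_mul, h0, mul_zero, map_pow,
    aeval_X] at h2
  exact h2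

/-- The uniform exponent turns nilpotency into a polynomial condition, which passes to Zariski
closures. -/
lemma pow_card_eq_zero_of_isNilpotent {n : ℕ} {A : Matrix (Fin n) (Fin n) ℝ}
    (h : IsNilpotent A) : A ^ n = 0 := by
  have h1 : IsNilpotent (Matrix.toLinAlgEquiv' A) := h.map _
  have h2 := LinearMap.charpoly_eq_X_pow_iff (Matrix.toLinAlgEquiv' A)
  have h3 := (LinearMap.aeval_self_charpoly (Matrix.toLinAlgEquiv' A))
  rw [h2.2 (fun m => by obtain ⟨k, hk⟩ := h1; exact ⟨k, by rw [hk]; rfl⟩)] at h3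
  simp only [map_pow, Polynomial.aeval_X, Module.finrank_fintype_fun_eq_card,
    Fintype.card_fin] at h3
  rw [← map_pow] at h3
  exact (map_eq_zero_iff _ (Matrix.toLinAlgEquiv').injective).1 h3

lemma isNilpotent_expGL_sub_one {n : ℕ} {A : Matrix (Fin n) (Fin n) ℝ} (h : IsNilpotent A) :
    IsNilpotent ((expGL A).1 - 1) := by
  have h0 := pow_card_eq_zero_of_isNilpotent h
  have h1 : (expGL A).1 = IsNilpotent.exp A := by
    rw [expGL_val, NormedSpace.exp_eq_tsum ℝ, IsNilpotent.exp_eq_sum h0]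
    simp only
    rw [tsum_eq_sum (s := Finset.range n)]
    · refine Finset.sum_congr rfl fun k _ => ?_
      ext i j
      simp [Matrix.smul_apply, Rat.smul_def]
    · intro k hk
      rw [Finset.mem_range, not_lt] at hk
      rw [pow_eq_zero_of_le hk h0, smul_zero]
  rw [h1]
  exact IsNilpotent.isNilpotent_exp_sub_one h

/-! ### Unipotent normal subgroups -/

lemma continuous_id_zariski (n : ℕ) :
    @Continuous (GL (Fin n) ℝ) (GL (Fin n) ℝ) inferInstance (zariskiTopology n) id := by
  rw [continuous_generateFrom_iff]
  rintro _ ⟨p, rfl⟩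
  have h : Continuous fun g : GL (Fin n) ℝ => MvPolynomial.eval (entries g) p := by
    refine (MvPolynomial.continuous_eval p).comp (continuous_pi fun ij => ?_)
    exact Units.continuous_val.matrix_elem ij.1 ij.2
  exact isOpen_ne.preimage h

/-! ### Zariski closures of unipotent groups -/

section zariskiClosure

variable {n : ℕ}

/-- The Zariski closure of a set of matrices. -/
def zariskiClosure (S : Set (GL (Fin n) ℝ)) : Set (GL (Fin n) ℝ) :=
  {g | ∀ p : MvPolynomial (Fin n × Fin n) ℝ, (∀ s ∈ S, MvPolynomial.eval (entries s) p = 0) →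
    MvPolynomial.eval (entries g) p = 0}

lemma subset_zariskiClosure (S : Set (GL (Fin n) ℝ)) : S ⊆ zariskiClosure S :=
  fun s hs _ hp => hp s hs

lemma isClosed_zariskiClosure (S : Set (GL (Fin n) ℝ)) :
    IsClosed[zariskiTopology n] (zariskiClosure S) := by
  let _ := zariskiTopology n
  have h : zariskiClosure S = ⋂ (p : MvPolynomial (Fin n × Fin n) ℝ)
      (_ : ∀ s ∈ S, MvPolynomial.eval (entries s) p = 0),
      {g : GL (Fin n) ℝ | MvPolynomial.eval (entries g) p ≠ 0}ᶜ := by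
    ext g
    simp [zariskiClosure]
  rw [h]
  refine isClosed_iInter fun p => isClosed_iInter fun _ => isClosed_compl_iff.2 ?_
  exact TopologicalSpace.isOpen_generateFrom_of_mem ⟨p, rfl⟩

lemma zariskiClosure_subset_closure (S : Set (GL (Fin n) ℝ)) :
    zariskiClosure S ⊆ @closure _ (zariskiTopology n) S := by
  let _ := zariskiTopology n
  intro g hg
  rw [(isTopologicalBasis_zariski n).mem_closure_iff]
  rintro _ ⟨p, rfl⟩ hgp
  by_contra hne
  refine hgp (hg p fun s hs => ?_)
  by_contra hsp
  exact hne ⟨s, hsp, hs⟩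

/-- Polynomiality of `f` is asked only on the closure of `S`, because inversion will be polynomial
only on unipotent matrices. -/
lemma maps_zariskiClosure {S T : Set (GL (Fin n) ℝ)} {f : GL (Fin n) ℝ → GL (Fin n) ℝ}
    (hf : Set.MapsTo f S T)
    (hpoly : ∀ p : MvPolynomial (Fin n × Fin n) ℝ, ∃ q, ∀ g ∈ zariskiClosure S,
      MvPolynomial.eval (entries (f g)) p = MvPolynomial.eval (entries g) q) :
    Set.MapsTo f (zariskiClosure S) (zariskiClosure T) := by
  intro g hg p hp
  obtain ⟨q, hq⟩ := hpoly p
  rw [hq g hg]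
  refine hg q fun s hs => ?_
  rw [← hq s (subset_zariskiClosure S hs)]
  exact hp _ (hf hs)

lemma pow_eq_zero_of_mem_zariskiClosure {S : Set (GL (Fin n) ℝ)}
    (hS : ∀ s ∈ S, (s.1 - 1) ^ n = 0) {g : GL (Fin n) ℝ} (hg : g ∈ zariskiClosure S) :
    (g.1 - 1) ^ n = 0 := by
  have hev : ∀ (h : GL (Fin n) ℝ) (i j : Fin n), MvPolynomial.eval (entries h)
      (((Matrix.mvPolynomialX (Fin n) (Fin n) ℝ - 1) ^ n) i j) = ((h.1 - 1) ^ n) i j := by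
    intro h i j
    have h1 : ((Matrix.mvPolynomialX (Fin n) (Fin n) ℝ - 1) ^ n).map
        (MvPolynomial.eval (entries h)) = (h.1 - 1) ^ n := by
      rw [← RingHom.mapMatrix_apply, map_pow, map_sub, map_one, RingHom.mapMatrix_apply,
        map_eval_mvPolynomialX]
    rw [← h1]
    rfl
  ext i j
  rw [← hev]
  refine hg _ fun s hs => ?_
  rw [hev, hS s hs]
  rfl

/-- The Zariski closure of a group of unipotent matrices is a group. -/
def unipotentClosure (S : Subgroup (GL (Fin n) ℝ)) (hS : ∀ s ∈ S, (s.1 - 1) ^ n = 0) :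
    Subgroup (GL (Fin n) ℝ) where
  carrier := zariskiClosure S
  one_mem' := subset_zariskiClosure _ S.one_mem
  mul_mem' := by
    have h1 : ∀ s ∈ S, ∀ g ∈ zariskiClosure (S : Set (GL (Fin n) ℝ)),
        s * g ∈ zariskiClosure (S : Set (GL (Fin n) ℝ)) := fun s hs =>
      maps_zariskiClosure (fun t ht => S.mul_mem hs ht)
        fun p => ⟨leftTrans s p, fun g _ => (eval_leftTrans s g p).symm⟩
    intro g h hg hh
    have h2 : Set.MapsTo (· * h) (zariskiClosure (S : Set (GL (Fin n) ℝ)))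
        (zariskiClosure (zariskiClosure (S : Set (GL (Fin n) ℝ)))) :=
      maps_zariskiClosure (fun s hs => h1 s hs h hh)
        fun p => ⟨rightTrans h p, fun g _ => (eval_rightTrans h g p).symm⟩
    exact fun p hp => h2 hg p fun k hk => hk p hp
  inv_mem' := by
    intro g hg
    refine maps_zariskiClosure (fun s hs => S.inv_mem hs) (fun p => ?_) hg
    -- The inverse of a unipotent `h` is the finite geometric series in `1 - h`.
    refine ⟨MvPolynomial.aeval (fun ij => (∑ k ∈ Finset.range n,
      (1 - Matrix.mvPolynomialX (Fin n) (Fin n) ℝ) ^ k) ij.1 ij.2) p, fun h hh => ?_⟩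
    have h1 : h⁻¹.1 = ∑ k ∈ Finset.range n, (1 - h.1) ^ k := by
      have h2 := mul_neg_geom_sum (1 - h.1) n
      rw [sub_sub_cancel, ← neg_sub, neg_pow, pow_eq_zero_of_mem_zariskiClosure hS hh, mul_zero,
        sub_zero, neg_sub] at h2
      calc h⁻¹.1 = h⁻¹.1 * (h.1 * ∑ k ∈ Finset.range n, (1 - h.1) ^ k) := by rw [h2, mul_one]
        _ = _ := by
          rw [← mul_assoc, ← Units.val_mul, inv_mul_cancel, Units.val_one, one_mul]
    have h3 : (∑ k ∈ Finset.range n, (1 - Matrix.mvPolynomialX (Fin n) (Fin n) ℝ) ^ k).map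
        (MvPolynomial.eval (entries h)) = h⁻¹.1 := by
      rw [h1, ← RingHom.mapMatrix_apply, map_sum]
      refine Finset.sum_congr rfl fun k _ => ?_
      rw [map_pow, map_sub, map_one, RingHom.mapMatrix_apply, map_eval_mvPolynomialX]
    have h4 : entries h⁻¹ = fun ij => MvPolynomial.eval (entries h) ((∑ k ∈ Finset.range n,
        (1 - Matrix.mvPolynomialX (Fin n) (Fin n) ℝ) ^ k) ij.1 ij.2) := by
      funext ij
      rw [entries, ← h3]
      rfl
    rw [h4]
    clear h4 h3 h1
    induction p using MvPolynomial.induction_on with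
    | C a => simp
    | add p q hp hq => simp only [map_add, hp, hq]
    | mul_X p ij hp => simp only [map_mul, hp, MvPolynomial.eval_X, MvPolynomial.aeval_X]

end zariskiClosure

/-- A reductive group has no infinitesimal abelian normal unipotent subgroups. -/
theorem eq_bot_of_isReductive {n : ℕ} {G : Subgroup (GL (Fin n) ℝ)} (hG : IsAlgebraic G)
    (hred : IsReductive G) {N : Submodule ℝ (Matrix (Fin n) (Fin n) ℝ)}
    (hN : ∀ X ∈ N, X ∈ lieAlgebra G) (hcomm : ∀ X ∈ N, ∀ Y ∈ N, Commute X Y)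
    (hnil : ∀ X ∈ N, IsNilpotent X) (hconj : ∀ g ∈ G, ∀ X ∈ N, g.1 * X * g⁻¹.1 ∈ N) : N = ⊥ := by
  let S : Subgroup (GL (Fin n) ℝ) :=
    { carrier := expGL '' N
      one_mem' := ⟨0, N.zero_mem, expGL_zero⟩
      mul_mem' := by
        rintro _ _ ⟨X, hX, rfl⟩ ⟨Y, hY, rfl⟩
        exact ⟨X + Y, N.add_mem hX hY, expGL_add (hcomm X hX Y hY)⟩
      inv_mem' := by
        rintro _ ⟨X, hX, rfl⟩
        exact ⟨-X, N.neg_mem hX, (expGL_inv X).symm⟩ }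
  have hS : ∀ s ∈ S, (s.1 - 1) ^ n = 0 := by
    rintro _ ⟨X, hX, rfl⟩
    exact pow_card_eq_zero_of_isNilpotent (isNilpotent_expGL_sub_one (hnil X hX))
  have hbot : unipotentClosure S hS = ⊥ := by
    refine hred _ ?_ (isClosed_zariskiClosure _) ?_ ?_ ?_
    · intro g hg
      refine mem_of_isAlgebraic hG fun p hp => hg p ?_
      rintro _ ⟨X, hX, rfl⟩
      exact hp _ (expGL_mem hG (hN X hX))
    · have hcont : @Continuous _ _ inferInstance (zariskiTopology n)
          (id ∘ expGL : Matrix (Fin n) (Fin n) ℝ → GL (Fin n) ℝ) :=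
        @Continuous.comp _ _ _ _ _ (zariskiTopology n) _ _ (continuous_id_zariski n)
          continuous_expGL
      let _ := zariskiTopology n
      refine IsConnected.subset_closure ⟨⟨1, S.one_mem⟩, ?_⟩ (subset_zariskiClosure _)
        (zariskiClosure_subset_closure _)
      -- `exp N` is the continuous image of a convex set, and its closure stays connected.
      exact N.convex.isPreconnected.image _ hcont.continuousOn
    · intro g hg
      refine maps_zariskiClosure (f := fun u => g * u * g⁻¹) ?_ fun p =>
        ⟨leftTrans g (rightTrans g⁻¹ p), fun h _ => ?_⟩
      · rintro _ ⟨X, hX, rfl⟩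
        exact ⟨_, hconj g hg X hX, (conj_expGL g X).symm⟩
      · rw [eval_leftTrans, eval_rightTrans]
    · exact fun u hu => ⟨n, pow_eq_zero_of_mem_zariskiClosure hS hu⟩
  rw [Submodule.eq_bot_iff]
  intro X hX
  have h1 : ∀ t : ℝ, expGL (t • X) = 1 := by
    intro t
    have h2 : expGL (t • X) ∈ unipotentClosure S hS :=
      subset_zariskiClosure _ ⟨t • X, N.smul_mem t hX, rfl⟩
    rwa [hbot, Subgroup.mem_bot] at h2
  have h3 := hasDerivAt_exp_smul X 0
  simp only [h1, Units.val_one, one_mul] at h3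
  exact h3.unique (hasDerivAt_const _ _)

/-! ### Pairs of elements of a reductive Lie algebra -/

/-- If `T` has maximal rank on the line `T + ℝ S` then `S` maps the kernel of `T` into the range
of `T`. -/
lemma mem_range_of_finrank_range_le {E F : Type*} [AddCommGroup E] [Module ℝ E]
    [AddCommGroup F] [Module ℝ F] [FiniteDimensional ℝ F] {T S : E →ₗ[ℝ] F}
    (h : ∀ t : ℝ, Module.finrank ℝ (LinearMap.range (T + t • S)) ≤
      Module.finrank ℝ (LinearMap.range T)) {v : E} (hv : T v = 0) :
    S v ∈ LinearMap.range T := by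
  by_contra hS
  let e := Module.finBasis ℝ F
  let φ := e.equivFun
  let b := Module.finBasis ℝ (LinearMap.range T)
  choose u hu using fun i => (b i).2
  have hli : LinearIndependent ℝ (Fin.cons (S v) (fun i => T (u i)) :
      Fin (Module.finrank ℝ (LinearMap.range T) + 1) → F) := by
    rw [linearIndependent_finCons]
    have hfun : (fun i => T (u i)) = fun i => ((b i : LinearMap.range T) : F) := funext hu
    rw [hfun]
    refine ⟨b.linearIndependent.map' (LinearMap.range T).subtype (Submodule.ker_subtype _), ?_⟩
    intro hmem
    refine hS (Submodule.span_le.2 ?_ hmem)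
    rintro _ ⟨i, rfl⟩
    exact (b i).2
  -- In coordinates, `S v` and the vectors `(T + t S) uᵢ`. They are independent at `t = 0`, hence
  -- for small `t`; for `t ≠ 0` all lie in the range of `T + t S`, since `S v = t⁻¹ (T + t S) v`,
  -- and the rank would be too large.
  let c : ℝ → Fin (Module.finrank ℝ (LinearMap.range T) + 1) → (Fin (Module.finrank ℝ F) → ℝ) :=
    fun t => Fin.cons (φ (S v)) (fun i => φ (T (u i)) + t • φ (S (u i)))
  have hc : Continuous c := by
    refine continuous_pi fun i => ?_
    refine Fin.cases ?_ (fun i => ?_) i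
    · simp only [c, Fin.cons_zero]; exact continuous_const
    · simp only [c, Fin.cons_succ]; fun_prop
  have h0 : LinearIndependent ℝ (c 0) := by
    have h1 := hli.map' φ.toLinearMap φ.ker
    have h2 : c 0 = φ.toLinearMap ∘ Fin.cons (S v) (fun i => T (u i)) := by
      funext i
      refine Fin.cases ?_ (fun i => ?_) i <;> simp [c]
    rw [h2]
    exact h1
  have hev : ∀ᶠ t in 𝓝 (0 : ℝ), LinearIndependent ℝ (c t) :=
    hc.continuousAt.eventually (isOpen_setOfPred_linearIndependent.mem_nhds h0)
  have hev' : ∀ᶠ t in 𝓝[≠] (0 : ℝ), LinearIndependent ℝ (c t) := hev.filter_mono nhdsWithin_le_nhds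
  obtain ⟨t, ht, ht0⟩ := (hev'.and self_mem_nhdsWithin).exists
  have ht0 : t ≠ 0 := ht0
  let w : Fin (Module.finrank ℝ (LinearMap.range T) + 1) → F :=
    Fin.cons (S v) (fun i => (T + t • S) (u i))
  have hw : LinearIndependent ℝ w := by
    have h1 : c t = φ.toLinearMap ∘ w := by
      funext i
      refine Fin.cases ?_ (fun i => ?_) i <;> simp [c, w]
    rw [h1] at ht
    exact ht.of_comp
  have hwr : ∀ i, w i ∈ LinearMap.range (T + t • S) := by
    refine Fin.cases ?_ fun i => ?_
    · exact ⟨t⁻¹ • v, by simp [w, hv, ht0]⟩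
    · exact ⟨u i, rfl⟩
  have h2 : LinearIndependent ℝ (fun i => (⟨w i, hwr i⟩ : LinearMap.range (T + t • S))) :=
    LinearIndependent.of_comp (LinearMap.range (T + t • S)).subtype hw
  have h3 := h2.fintype_card_le_finrank
  rw [Fintype.card_fin] at h3
  have := h t
  omega

lemma exists_forall_finrank_range_le {ι E F : Type*} [Nonempty ι] [AddCommGroup E] [Module ℝ E]
    [AddCommGroup F] [Module ℝ F] [FiniteDimensional ℝ F] (T : ι → E →ₗ[ℝ] F) :
    ∃ i, ∀ j, Module.finrank ℝ (LinearMap.range (T j)) ≤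
      Module.finrank ℝ (LinearMap.range (T i)) := by
  have hfin : (Set.range fun i => Module.finrank ℝ (LinearMap.range (T i))).Finite :=
    (Set.finite_Iic (Module.finrank ℝ F)).subset (by
      rintro _ ⟨i, rfl⟩
      exact Submodule.finrank_le _)
  obtain ⟨_, ⟨i, rfl⟩, hi⟩ := hfin.exists_maximal (Set.range_nonempty _)
  refine ⟨i, fun j => ?_⟩
  rcases le_total (Module.finrank ℝ (LinearMap.range (T j)))
    (Module.finrank ℝ (LinearMap.range (T i))) with h | h
  · exact h
  · exact hi ⟨j, rfl⟩ h

section pairs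

open LieAlgebra

variable {L : Type*} [LieRing L] [LieAlgebra ℝ L]

/-- An element with `(ad z)² = 0` lies in the radical of the Killing form. -/
lemma killingForm_eq_zero_of_lie_lie {z : L} (hz : ∀ u : L, ⁅z, ⁅z, u⁆⁆ = 0) (u : L) :
    killingForm ℝ L z u = 0 := by
  -- Expanding `(ad z)² ⁅u, v⁆ = 0` leaves `2 ⁅⁅z, u⁆, ⁅z, v⁆⁆ = 0`. The result `ad z ∘ ad u ∘ ad z
  -- = 0` makes `ad z ∘ ad u` square to zero, hence traceless.
  have h2 : ∀ u v : L, ⁅z, ⁅u, ⁅z, v⁆⁆⁆ = 0 := by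
    intro u v
    have h1 := hz ⁅u, v⁆
    rw [leibniz_lie z u v, lie_add, leibniz_lie z ⁅z, u⁆, leibniz_lie z u ⁅z, v⁆, hz, hz] at h1
    simp only [zero_lie, zero_add, lie_zero, add_zero] at h1
    have h3 : ⁅⁅z, u⁆, ⁅z, v⁆⁆ = ⁅z, ⁅u, ⁅z, v⁆⁆⁆ := by
      rw [leibniz_lie z u ⁅z, v⁆, hz]; simp
    rw [h3] at h1
    have : (2 : ℝ) • ⁅z, ⁅u, ⁅z, v⁆⁆⁆ = 0 := by rw [two_smul]; exact h1
    simpa using this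
  rw [killingForm_apply_apply]
  refine (LinearMap.isNilpotent_trace_of_isNilpotent ⟨2, ?_⟩).eq_zero
  ext v
  simp [pow_two, h2]

/-- In a Lie algebra whose Killing form degenerates only along the center, and whose center meets
the derived algebra trivially, there are two elements with only central common commutants. -/
lemma exists_pair_centralizer [FiniteDimensional ℝ L]
    (hker : ∀ z : L, (∀ u, killingForm ℝ L z u = 0) → z ∈ center ℝ L)
    (hcen : ∀ z : L, z ∈ center ℝ L →
      z ∈ ⁅(⊤ : LieIdeal ℝ L), (⊤ : LieIdeal ℝ L)⁆ → z = 0) :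
    ∃ X Y : L, ∀ z : L, ⁅X, z⁆ = 0 → ⁅Y, z⁆ = 0 → z ∈ center ℝ L := by
  obtain ⟨Y, hY⟩ := exists_forall_finrank_range_le (fun Y : L => (ad ℝ L Y : L →ₗ[ℝ] L))
  obtain ⟨X, hX⟩ := exists_forall_finrank_range_le
    (fun X : L => (ad ℝ L X : L →ₗ[ℝ] L).prod (ad ℝ L Y : L →ₗ[ℝ] L))
  refine ⟨X, Y, fun z hXz hYz => ?_⟩
  have inv : ∀ a b c : L, killingForm ℝ L ⁅a, b⁆ c = killingForm ℝ L a ⁅b, c⁆ :=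
    LieModule.traceForm_apply_lie_apply ℝ L L
  -- the centralizer of `Y` is abelian
  have habel : ∀ c c' : L, ⁅Y, c⁆ = 0 → ⁅Y, c'⁆ = 0 → ⁅c, c'⁆ = 0 := by
    intro c c' hc hc'
    refine hcen _ (hker _ fun u => ?_) (LieSubmodule.lie_mem_lie trivial trivial)
    -- Maximality of the rank of `ad Y` puts `⁅u, c⁆` in the range of `ad Y`, which is Killing
    -- orthogonal to the centralizer of `Y`, in particular to `c'`.
    have h1 : ⁅u, c⁆ ∈ LinearMap.range (ad ℝ L Y : L →ₗ[ℝ] L) := by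
      refine mem_range_of_finrank_range_le (S := (ad ℝ L u : L →ₗ[ℝ] L)) (fun t => ?_) hc
      have := hY (Y + t • u)
      rw [map_add, map_smul] at this
      exact this
    obtain ⟨w, hw⟩ := h1
    rw [LieModule.traceForm_comm, ← inv, ← hw]
    rw [ad_apply, LieModule.traceForm_comm, ← inv, ← lie_skew, hc']
    simp
  -- Here only `X` is varied, so the perturbation is `(ad u, 0)` and the preimage `w` still
  -- centralizes `Y`.
  have hrange : ∀ u : L, ∃ w, ⁅Y, w⁆ = 0 ∧ ⁅X, w⁆ = ⁅u, z⁆ := by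
    intro u
    have h1 : ((ad ℝ L u : L →ₗ[ℝ] L).prod 0) z ∈
        LinearMap.range ((ad ℝ L X : L →ₗ[ℝ] L).prod (ad ℝ L Y : L →ₗ[ℝ] L)) := by
      refine mem_range_of_finrank_range_le (fun t => ?_) (by simp [hXz, hYz])
      have h2 := hX (X + t • u)
      have h3 : (ad ℝ L X : L →ₗ[ℝ] L).prod (ad ℝ L Y : L →ₗ[ℝ] L) +
          t • (ad ℝ L u : L →ₗ[ℝ] L).prod 0 =
          (ad ℝ L (X + t • u) : L →ₗ[ℝ] L).prod (ad ℝ L Y : L →ₗ[ℝ] L) := by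
        apply LinearMap.ext
        intro v
        simp
      rw [h3]
      exact h2
    obtain ⟨w, hw⟩ := h1
    exact ⟨w, congrArg Prod.snd hw, congrArg Prod.fst hw⟩
  -- `z` commutes with `X`, and with `w` because both centralize `Y`; so it kills `⁅X, w⁆ = ⁅u, z⁆`,
  -- that is, `(ad z)² = 0`.
  refine hker z (killingForm_eq_zero_of_lie_lie fun u => ?_)
  obtain ⟨w, hYw, hXw⟩ := hrange u
  have hzX : ⁅z, X⁆ = 0 := by rw [← lie_skew, hXz, neg_zero]
  rw [← lie_skew z u, lie_neg, ← hXw, leibniz_lie, hzX, habel z w hYz hYw]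
  simp

/-- By invariance, the Killing orthogonal of `⁅X, L⁆ + ⁅Y, L⁆` consists of `z` for which `⁅X, z⁆`
and `⁅Y, z⁆` lie in the Killing radical. They are then central and derived, so zero, and `z` is
central; a dimension count concludes. -/
lemma exists_pair_finrank [FiniteDimensional ℝ L]
    (hker : ∀ z : L, (∀ u, killingForm ℝ L z u = 0) → z ∈ center ℝ L)
    (hcen : ∀ z : L, z ∈ center ℝ L →
      z ∈ ⁅(⊤ : LieIdeal ℝ L), (⊤ : LieIdeal ℝ L)⁆ → z = 0) :
    ∃ X Y : L, Module.finrank ℝ L ≤ Module.finrank ℝ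
      (LinearMap.range ((ad ℝ L X : L →ₗ[ℝ] L).coprod (ad ℝ L Y : L →ₗ[ℝ] L))) +
        Module.finrank ℝ (center ℝ L) := by
  obtain ⟨X, Y, hXY⟩ := exists_pair_centralizer hker hcen
  refine ⟨X, Y, ?_⟩
  set M := LinearMap.range ((ad ℝ L X : L →ₗ[ℝ] L).coprod (ad ℝ L Y : L →ₗ[ℝ] L))
  let r : L →ₗ[ℝ] Module.Dual ℝ M := (Module.Dual.transpose M.subtype) ∘ₗ killingForm ℝ L
  have inv : ∀ a b c : L, killingForm ℝ L ⁅a, b⁆ c = killingForm ℝ L a ⁅b, c⁆ :=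
    LieModule.traceForm_apply_lie_apply ℝ L L
  have key : ∀ A z : L, (∀ u, killingForm ℝ L z ⁅A, u⁆ = 0) → ⁅A, z⁆ = 0 := by
    intro A z h
    refine hcen _ (hker _ fun u => ?_) (LieSubmodule.lie_mem_lie trivial trivial)
    rw [← lie_skew, map_neg, LinearMap.neg_apply, inv, h, neg_zero]
  have hr : LinearMap.ker r ≤ (center ℝ L).toSubmodule := by
    intro z hz
    have hz' : ∀ m ∈ M, killingForm ℝ L z m = 0 := fun m hm =>
      LinearMap.congr_fun (LinearMap.mem_ker.1 hz) (⟨m, hm⟩ : M)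
    exact hXY z (key X z fun u => hz' _ ⟨(u, 0), by simp⟩)
      (key Y z fun u => hz' _ ⟨(0, u), by simp⟩)
  have h1 := LinearMap.finrank_range_add_finrank_ker r
  have h2 : Module.finrank ℝ (LinearMap.range r) ≤ Module.finrank ℝ M := by
    rw [← Subspace.dual_finrank_eq (K := ℝ) (V := M)]
    exact Submodule.finrank_le _
  have h3 : Module.finrank ℝ (LinearMap.ker r) ≤ Module.finrank ℝ (center ℝ L) :=
    Submodule.finrank_mono hr
  omega

end pairs

/-! ### The Lie algebra of a reductive group -/

section reductive

open LieAlgebra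

variable {n : ℕ} {G : Subgroup (GL (Fin n) ℝ)}

lemma coe_lie_lieAlgebra (x y : lieAlgebra G) :
    (⁅x, y⁆ : lieAlgebra G).1 = x.1 * y.1 - y.1 * x.1 := rfl

lemma commute_of_lie_eq_zero {x y : lieAlgebra G} (h : ⁅x, y⁆ = 0) : Commute x.1 y.1 := by
  have h1 := congrArg Subtype.val h
  rw [coe_lie_lieAlgebra] at h1
  exact sub_eq_zero.1 h1

/-- The derived algebra of the Lie algebra of `G`. -/
abbrev derivedIdeal (G : Subgroup (GL (Fin n) ℝ)) : LieIdeal ℝ (lieAlgebra G) :=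
  ⁅(⊤ : LieIdeal ℝ (lieAlgebra G)), (⊤ : LieIdeal ℝ (lieAlgebra G))⁆

/-- Cyclicity of the trace: `tr([x, y] C) = tr(x [y, C])`. -/
lemma trace_mul_eq_zero_of_mem_lie {I : LieIdeal ℝ (lieAlgebra G)} {z : lieAlgebra G}
    (hz : z ∈ ⁅(⊤ : LieIdeal ℝ (lieAlgebra G)), I⁆) {C : Matrix (Fin n) (Fin n) ℝ}
    (hC : ∀ y ∈ I, Commute C y.1) : (z.1 * C).trace = 0 := by
  rw [← LieSubmodule.mem_toSubmodule, LieSubmodule.lieIdeal_oper_eq_linear_span'] at hz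
  induction hz using Submodule.span_induction with
  | mem z hz =>
    obtain ⟨x, -, y, hy, rfl⟩ := hz
    rw [coe_lie_lieAlgebra, sub_mul, Matrix.trace_sub, mul_assoc y.1, Matrix.trace_mul_comm y.1,
      mul_assoc, mul_assoc, (hC y hy).eq, sub_self]
  | zero => simp
  | add a b _ _ ha hb =>
    change ((a.1 + b.1) * C).trace = 0
    rw [add_mul, Matrix.trace_add, ha, hb, add_zero]
  | smul c a _ ha =>
    change ((c • a.1) * C).trace = 0
    rw [Matrix.smul_mul, Matrix.trace_smul, ha, smul_zero]

/-- Taking `C = z ^ k` above, all positive powers of `z` have trace zero. -/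
lemma isNilpotent_of_mem_lie {I : LieIdeal ℝ (lieAlgebra G)} {z : lieAlgebra G}
    (hz : z ∈ ⁅(⊤ : LieIdeal ℝ (lieAlgebra G)), I⁆) (hC : ∀ y ∈ I, ⁅z, y⁆ = 0) :
    IsNilpotent z.1 := by
  refine isNilpotent_of_trace_pow_eq_zero fun k => ?_
  rw [pow_succ']
  exact trace_mul_eq_zero_of_mem_lie hz fun y hy => (commute_of_lie_eq_zero (hC y hy)).pow_left k

/-- Connectedness upgrades stability under `𝔤` to stability under conjugation by `G`, so
`eq_bot_of_isReductive` applies. -/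
lemma lieIdeal_eq_bot (hG : IsAlgebraic G) (hconn : IsZariskiConnected G) (hred : IsReductive G)
    {I : LieIdeal ℝ (lieAlgebra G)} (hab : ∀ x ∈ I, ∀ y ∈ I, ⁅x, y⁆ = 0)
    (hnil : ∀ x ∈ I, IsNilpotent x.1) : I = ⊥ := by
  let N : Submodule ℝ (Matrix (Fin n) (Fin n) ℝ) :=
    I.toSubmodule.map (lieAlgebra G).toSubmodule.subtype
  have hN : N = ⊥ := by
    refine eq_bot_of_isReductive hG hred ?_ ?_ ?_ ?_
    · rintro _ ⟨x, _, rfl⟩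
      exact x.2
    · rintro _ ⟨x, hx, rfl⟩ _ ⟨y, hy, rfl⟩
      exact commute_of_lie_eq_zero (hab x hx y hy)
    · rintro _ ⟨x, hx, rfl⟩
      exact hnil x hx
    · intro g hg X hX
      have h1 := conj_sub_mem hconn (le_refl N) (by
        rintro Y hY _ ⟨x, hx, rfl⟩
        exact ⟨⁅(⟨Y, hY⟩ : lieAlgebra G), x⁆, lie_mem_right ℝ _ I _ _ hx, rfl⟩) hg hX
      simpa using N.add_mem h1 hX
  rw [LieSubmodule.eq_bot_iff]
  intro x hx
  have h1 : x.1 ∈ N := ⟨x, hx, rfl⟩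
  rw [hN, Submodule.mem_bot] at h1
  exact Subtype.ext h1

lemma mem_center_iff_lie {z : lieAlgebra G} :
    z ∈ center ℝ (lieAlgebra G) ↔ ∀ x : lieAlgebra G, ⁅x, z⁆ = 0 :=
  LieModule.mem_maxTrivSubmodule ℝ _ _ z

lemma center_inf_derived (hG : IsAlgebraic G) (hconn : IsZariskiConnected G)
    (hred : IsReductive G) : center ℝ (lieAlgebra G) ⊓
      derivedIdeal G = ⊥ := by
  have hz : ∀ z ∈ center ℝ (lieAlgebra G), ∀ y : lieAlgebra G, ⁅z, y⁆ = 0 := fun z hz y => by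
    rw [← lie_skew, mem_center_iff_lie.1 hz, neg_zero]
  refine lieIdeal_eq_bot hG hconn hred (fun x hx y _ => hz x hx.1 y) fun x hx => ?_
  exact isNilpotent_of_mem_lie hx.2 fun y _ => hz x hx.1 y

/-- The ideal `⁅𝔤, I⁆` is contained in `I`, hence abelian, and consists of nilpotent matrices by the
trace argument, so it vanishes. -/
lemma le_center_of_isLieAbelian (hG : IsAlgebraic G) (hconn : IsZariskiConnected G)
    (hred : IsReductive G) {I : LieIdeal ℝ (lieAlgebra G)} (hI : ⁅I, I⁆ = ⊥) :
    I ≤ center ℝ (lieAlgebra G) := by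
  have hab : ∀ x ∈ I, ∀ y ∈ I, ⁅x, y⁆ = 0 := fun x hx y hy => by
    have h1 : ⁅x, y⁆ ∈ ⁅I, I⁆ := LieSubmodule.lie_mem_lie hx hy
    rwa [hI, LieSubmodule.mem_bot] at h1
  have hle : ⁅(⊤ : LieIdeal ℝ (lieAlgebra G)), I⁆ ≤ I := LieSubmodule.lie_le_right I ⊤
  have h1 : ⁅(⊤ : LieIdeal ℝ (lieAlgebra G)), I⁆ = ⊥ :=
    lieIdeal_eq_bot hG hconn hred (fun x hx y hy => hab x (hle hx) y (hle hy))
      fun x hx => isNilpotent_of_mem_lie hx fun y hy => hab x (hle hx) y hy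
  intro y hy
  rw [mem_center_iff_lie]
  intro x
  have h2 : ⁅x, y⁆ ∈ ⁅(⊤ : LieIdeal ℝ (lieAlgebra G)), I⁆ := LieSubmodule.lie_mem_lie trivial hy
  rwa [h1, LieSubmodule.mem_bot] at h2

lemma radical_eq_center (hG : IsAlgebraic G) (hconn : IsZariskiConnected G)
    (hred : IsReductive G) : radical ℝ (lieAlgebra G) = center ℝ (lieAlgebra G) := by
  refine le_antisymm ?_ (center_le_radical ℝ _)
  obtain ⟨k, hk⟩ := (isSolvable_iff ℝ (radical ℝ (lieAlgebra G))).1 inferInstance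
  rw [LieIdeal.derivedSeries_eq_bot_iff] at hk
  induction k with
  | zero =>
    rw [derivedSeriesOfIdeal_zero] at hk
    rw [hk]
    exact bot_le
  | succ k ih =>
    rw [derivedSeriesOfIdeal_succ] at hk
    have h1 := le_center_of_isLieAbelian hG hconn hred hk
    cases k with
    | zero => simpa using h1
    | succ k =>
      -- The last derived term is central, and from the first step of the series on it also lies in
      -- `[𝔤,𝔤]`; hence it is zero and the series can be shortened.
      refine ih (le_bot_iff.1 ?_)
      rw [← center_inf_derived hG hconn hred]
      refine le_inf h1 ?_
      rw [derivedSeriesOfIdeal_succ]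
      exact LieSubmodule.mono_lie le_top le_top

lemma finrank_derived_add_finrank_radical_le (hG : IsAlgebraic G) (hconn : IsZariskiConnected G)
    (hred : IsReductive G) :
    Module.finrank ℝ (derivedIdeal G) +
      Module.finrank ℝ (radical ℝ (lieAlgebra G)) ≤ Module.finrank ℝ (lieAlgebra G) := by
  have h1 := center_inf_derived hG hconn hred
  rw [← radical_eq_center hG hconn hred] at h1
  have h2 := congrArg LieSubmodule.toSubmodule h1
  rw [LieSubmodule.inf_toSubmodule, LieSubmodule.bot_toSubmodule] at h2
  have h3 := Submodule.finrank_sup_add_finrank_inf_eq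
    (radical ℝ (lieAlgebra G)).toSubmodule
    (derivedIdeal G).toSubmodule
  rw [h2, finrank_bot, add_zero] at h3
  have h4 := Submodule.finrank_le ((radical ℝ (lieAlgebra G)).toSubmodule ⊔
    (derivedIdeal G).toSubmodule)
  rw [h3, add_comm] at h4
  exact h4

lemma exists_pair_of_isReductive (hG : IsAlgebraic G) (hconn : IsZariskiConnected G)
    (hred : IsReductive G) :
    ∃ X Y : lieAlgebra G, Module.finrank ℝ (lieAlgebra G) ≤ Module.finrank ℝ
      (LinearMap.range ((ad ℝ (lieAlgebra G) X : lieAlgebra G →ₗ[ℝ] lieAlgebra G).coprod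
        (ad ℝ (lieAlgebra G) Y : lieAlgebra G →ₗ[ℝ] lieAlgebra G))) +
        Module.finrank ℝ (radical ℝ (lieAlgebra G)) := by
  have h := radical_eq_center hG hconn hred
  rw [h]
  refine exists_pair_finrank (fun z hz => ?_) fun z hz hz' => ?_
  · rw [← h]
    refine killingCompl_top_le_radical ℝ _ ?_
    rw [LieIdeal.mem_killingCompl]
    intro y _
    rw [LieModule.traceForm_comm]
    exact hz y
  · have h1 : z ∈ center ℝ (lieAlgebra G) ⊓
      derivedIdeal G := ⟨hz, hz'⟩
    rwa [center_inf_derived hG hconn hred, LieSubmodule.mem_bot] at h1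

/-- A connected group acts trivially on the abelianization of its Lie algebra. -/
lemma adjoint_sub_mem (hconn : IsZariskiConnected G) (g : G) (v : lieAlgebra G) :
    adjoint G g v - v ∈
      derivedIdeal G := by
  let D := derivedIdeal G
  have h1 := conj_sub_mem hconn (W := (lieAlgebra G).toSubmodule)
    (W' := D.toSubmodule.map (lieAlgebra G).toSubmodule.subtype)
    (Submodule.map_subtype_le _ _) (by
      intro X hX w hw
      exact ⟨⁅(⟨X, hX⟩ : lieAlgebra G), ⟨w, hw⟩⁆, LieSubmodule.lie_mem_lie trivial trivial, rfl⟩)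
    g.2 v.2
  obtain ⟨y, hy, hy'⟩ := h1
  have h2 : adjoint G g v - v = y := Subtype.ext hy'.symm
  rw [h2]
  exact hy

end reductive

/-! ### Crossed homomorphisms on free groups -/

section crossed

variable {S H V : Type*} [Group H] [AddCommGroup V] [Module ℝ V] (ρ : Representation ℝ H V)

/-- The affine bijection `v ↦ ρ h v + u`. -/
def affinePerm (h : H) (u : V) : Equiv.Perm V where
  toFun v := ρ h v + u
  invFun v := ρ h⁻¹ (v - u)
  left_inv v := by
    simp only
    rw [add_sub_cancel_right, ← Module.End.mul_apply, ← map_mul, inv_mul_cancel, map_one,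
      Module.End.one_apply]
  right_inv v := by
    simp only
    rw [← Module.End.mul_apply, ← map_mul, mul_inv_cancel, map_one, Module.End.one_apply,
      sub_add_cancel]

/-- The affine action of the free group in which the generator `s` acts by `v ↦ ρ (a s) v + u s`. -/
def affineAction (a : S → H) (u : S → V) : FreeGroup S →* Equiv.Perm V :=
  FreeGroup.lift fun s => affinePerm ρ (a s) (u s)

/-- The crossed homomorphism on the free group with values `u` on the generators. -/
def crossed (a : S → H) (u : S → V) (w : FreeGroup S) : V := affineAction ρ a u w 0

lemma affineAction_apply (a : S → H) (u : S → V) (w : FreeGroup S) (v : V) :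
    affineAction ρ a u w v = ρ (FreeGroup.lift a w) v + crossed ρ a u w := by
  induction w using FreeGroup.induction_on generalizing v with
  | C1 => simp [crossed]
  | of s => simp [crossed, affineAction, affinePerm]
  | inv_of s _ =>
    simp [crossed, affineAction, affinePerm, Equiv.Perm.inv_def, Equiv.symm, sub_eq_add_neg]
  | mul x y hx hy =>
    have h : ∀ v, affineAction ρ a u (x * y) v =
        ρ (FreeGroup.lift a (x * y)) v + (ρ (FreeGroup.lift a x) (crossed ρ a u y) +
          crossed ρ a u x) := by
      intro v
      rw [map_mul, Equiv.Perm.mul_apply, hy, hx, map_mul, map_mul, Module.End.mul_apply, map_add]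
      abel
    rw [crossed, h v, h 0, map_zero, zero_add]

lemma crossed_one (a : S → H) (u : S → V) : crossed ρ a u 1 = 0 := by simp [crossed]

lemma crossed_of (a : S → H) (u : S → V) (s : S) : crossed ρ a u (FreeGroup.of s) = u s := by
  simp [crossed, affineAction, affinePerm]

lemma crossed_mul (a : S → H) (u : S → V) (x y : FreeGroup S) :
    crossed ρ a u (x * y) = crossed ρ a u x + ρ (FreeGroup.lift a x) (crossed ρ a u y) := by
  rw [crossed, map_mul, Equiv.Perm.mul_apply, affineAction_apply, add_comm]
  rfl

lemma crossed_inv (a : S → H) (u : S → V) (x : FreeGroup S) :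
    crossed ρ a u x⁻¹ = -ρ (FreeGroup.lift a x)⁻¹ (crossed ρ a u x) := by
  have h := crossed_mul ρ a u x⁻¹ x
  rw [inv_mul_cancel, crossed_one, map_inv] at h
  exact eq_neg_of_add_eq_zero_left h.symm

lemma crossed_unique {a : S → H} {u : S → V} {f : FreeGroup S → V}
    (hof : ∀ s, f (FreeGroup.of s) = u s)
    (hmul : ∀ x y, f (x * y) = f x + ρ (FreeGroup.lift a x) (f y)) (w : FreeGroup S) :
    f w = crossed ρ a u w := by
  have h1 : f 1 = 0 := by
    have := hmul 1 1
    simpa using this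
  have hinv : ∀ x, f x = crossed ρ a u x → f x⁻¹ = crossed ρ a u x⁻¹ := by
    intro x hx
    have h2 := hmul x⁻¹ x
    rw [inv_mul_cancel, h1, map_inv, hx] at h2
    rw [crossed_inv]
    exact eq_neg_of_add_eq_zero_left h2.symm
  induction w using FreeGroup.induction_on with
  | C1 => rw [h1, crossed_one]
  | of s => rw [hof, crossed_of]
  | inv_of s hs => exact hinv _ hs
  | mul x y hx hy => rw [hmul, crossed_mul, hx, hy]

/-- The crossed homomorphisms evaluated at the word `w`. -/
def crossedMap (a : S → H) (w : FreeGroup S) : (S → V) →ₗ[ℝ] V where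
  toFun u := crossed ρ a u w
  map_add' u v := by
    symm
    refine crossed_unique ρ (f := fun w => crossed ρ a u w + crossed ρ a v w)
      (fun s => by simp [crossed_of]) (fun x y => ?_) w
    simp only [crossed_mul, map_add]
    abel
  map_smul' c u := by
    symm
    refine crossed_unique ρ (f := fun w => c • crossed ρ a u w)
      (fun s => by simp [crossed_of]) (fun x y => ?_) w
    simp only [crossed_mul, smul_add, map_smul]

lemma crossedMap_apply (a : S → H) (w : FreeGroup S) (u : S → V) :
    crossedMap ρ a w u = crossed ρ a u w := rfl

/-- Modulo a subspace on whose quotient the action is trivial, crossed homomorphisms are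
homomorphisms to an abelian group. -/
lemma crossed_mem {D : Submodule ℝ V} (hD : ∀ h v, ρ h v - v ∈ D) (a : S → H) (u : S → V)
    {w : FreeGroup S}
    (hw : FreeGroup.lift (fun s => Multiplicative.ofAdd (D.mkQ (u s))) w = 1) :
    crossed ρ a u w ∈ D := by
  have h : ∀ w, Multiplicative.ofAdd (D.mkQ (crossed ρ a u w)) =
      FreeGroup.lift (fun s => Multiplicative.ofAdd (D.mkQ (u s))) w := by
    have hq : ∀ h v, D.mkQ (ρ h v) = D.mkQ v := fun h v => by
      rw [← sub_eq_zero, ← map_sub]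
      rw [Submodule.mkQ_apply, Submodule.Quotient.mk_eq_zero]
      exact hD h v
    intro w
    induction w using FreeGroup.induction_on with
    | C1 => simp [crossed_one]
    | of s => simp [crossed_of]
    | inv_of s hs => rw [crossed_inv, map_neg, hq, ofAdd_neg, hs, map_inv]
    | mul x y hx hy => rw [crossed_mul, map_add, hq, ofAdd_add, hx, hy, map_mul]
  have h1 := (h w).trans hw
  rw [ofAdd_eq_one] at h1
  simpa using h1

end crossed

/-! ### Cocycles on surface groups -/

/-- The relator of the surface group. -/
def surfaceRelator (γ : ℕ) : FreeGroup (Fin γ × Bool) :=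
  (List.ofFn fun i : Fin γ => FreeGroup.of (i, false) * FreeGroup.of (i, true) *
      (FreeGroup.of (i, false))⁻¹ * (FreeGroup.of (i, true))⁻¹).prod

section cocycles

variable {n γ : ℕ} {G : Subgroup (GL (Fin n) ℝ)}

/-- The values of a homomorphism on the standard generators. -/
def genValues (φ : SurfaceGroup γ →* G) (s : Fin γ × Bool) : G := φ (PresentedGroup.of s)

lemma lift_genValues (φ : SurfaceGroup γ →* G) (w : FreeGroup (Fin γ × Bool)) :
    FreeGroup.lift (genValues φ) w = φ (PresentedGroup.mk _ w) := by
  have h : FreeGroup.lift (genValues φ) = φ.comp (PresentedGroup.mk _) := by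
    ext s
    simp [genValues, PresentedGroup.of]
  rw [h]
  rfl

lemma mk_surfaceRelator (γ : ℕ) :
    (PresentedGroup.mk _ (surfaceRelator γ) : SurfaceGroup γ) = 1 :=
  PresentedGroup.one_of_mem rfl

lemma mem_cocycles₁_of_iff {Γ V : Type} [Group Γ] [AddCommGroup V] [Module ℝ V]
    (ρ : Representation ℝ Γ V) {f : Γ → V} :
    f ∈ groupCohomology.cocycles₁ (Rep.of ρ) ↔ ∀ x y, f (x * y) = ρ x (f y) + f x :=
  groupCohomology.mem_cocycles₁_iff (A := Rep.of ρ) f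

lemma mem_cocycleSpace_iff {φ : SurfaceGroup γ →* G} {f : SurfaceGroup γ → lieAlgebra G} :
    f ∈ cocycleSpace φ ↔ ∀ x y, f (x * y) = adjoint G (φ x) (f y) + f x :=
  mem_cocycles₁_of_iff ((adjoint G).comp φ)

lemma crossed_eq_of_mem (φ : SurfaceGroup γ →* G) {f : SurfaceGroup γ → lieAlgebra G}
    (hf : f ∈ cocycleSpace φ) (w : FreeGroup (Fin γ × Bool)) :
    f (PresentedGroup.mk _ w) =
      crossed (adjoint G) (genValues φ) (fun s => f (PresentedGroup.of s)) w := by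
  refine crossed_unique (adjoint G) (f := fun w => f (PresentedGroup.mk _ w)) (fun s => rfl)
    (fun x y => ?_) w
  rw [lift_genValues, map_mul, mem_cocycleSpace_iff.1 hf, add_comm]

/-- A cocycle is determined by its values on the generators, which are subject to one relation. -/
def cocycleEquiv (φ : SurfaceGroup γ →* G) : cocycleSpace φ ≃ₗ[ℝ]
    LinearMap.ker (crossedMap (adjoint G) (genValues φ) (surfaceRelator γ)) := by
  refine LinearEquiv.ofBijective (((LinearMap.funLeft ℝ (lieAlgebra G)
    (PresentedGroup.of : Fin γ × Bool → SurfaceGroup γ)).domRestrict (cocycleSpace φ)).codRestrict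
      _ fun f => ?_) ⟨?_, ?_⟩
  · have h := crossed_eq_of_mem φ f.2 (surfaceRelator γ)
    have h1 := mem_cocycleSpace_iff.1 f.2 1 1
    rw [map_one, map_one, Module.End.one_apply, mul_one, left_eq_add] at h1
    rw [mk_surfaceRelator, h1] at h
    exact h.symm
  · intro f f' hff'
    have h1 : (fun s => f.1 (PresentedGroup.of s)) = fun s => f'.1 (PresentedGroup.of s) :=
      congrArg Subtype.val hff'
    refine Subtype.ext (funext fun x => ?_)
    obtain ⟨w, rfl⟩ := PresentedGroup.mk_surjective _ x
    rw [crossed_eq_of_mem φ f.2, crossed_eq_of_mem φ f'.2, h1]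
  · rintro ⟨u, hu⟩
    rw [LinearMap.mem_ker, crossedMap_apply] at hu
    -- The relator acts with trivial linear part because `φ` respects it, and without translation by
    -- `hu`. The affine action descends, and the orbit map of `0` is the cocycle.
    have hrel : ∀ r ∈ ({surfaceRelator γ} : Set (FreeGroup (Fin γ × Bool))),
        affineAction (adjoint G) (genValues φ) u r = 1 := by
      rintro r rfl
      ext1 v
      rw [affineAction_apply, hu, lift_genValues, mk_surfaceRelator, map_one, map_one, add_zero]
      rfl
    let Φ : SurfaceGroup γ →* Equiv.Perm (lieAlgebra G) := PresentedGroup.toGroup hrel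
    have hΦ : ∀ w, Φ (PresentedGroup.mk _ w) = affineAction (adjoint G) (genValues φ) u w :=
      fun w => rfl
    refine ⟨⟨fun x => Φ x 0, ?_⟩, ?_⟩
    · refine mem_cocycleSpace_iff.2 fun x y => ?_
      obtain ⟨x, rfl⟩ := PresentedGroup.mk_surjective _ x
      obtain ⟨y, rfl⟩ := PresentedGroup.mk_surjective _ y
      rw [← map_mul, hΦ, hΦ, hΦ]
      have h := crossed_mul (adjoint G) (genValues φ) u x y
      rw [lift_genValues, add_comm] at h
      exact h
    · refine Subtype.ext (funext fun s => ?_)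
      exact crossed_of (adjoint G) (genValues φ) u s

lemma finrank_cocycleSpace (φ : SurfaceGroup γ →* G) :
    Module.finrank ℝ (cocycleSpace φ) + Module.finrank ℝ (LinearMap.range
      (crossedMap (adjoint G) (genValues φ) (surfaceRelator γ))) =
      2 * γ * Module.finrank ℝ (lieAlgebra G) := by
  rw [(cocycleEquiv φ).finrank_eq, add_comm, LinearMap.finrank_range_add_finrank_ker,
    Module.finrank_pi_fintype, Finset.sum_const, smul_eq_mul, Finset.card_univ, Fintype.card_prod,
    Fintype.card_fin, Fintype.card_bool, mul_comm γ 2]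

/-- Modulo `[𝔤,𝔤]` the action is trivial, so crossed homomorphisms become homomorphisms to an
abelian group and kill commutators. -/
lemma range_crossedMap_le (hconn : IsZariskiConnected G) (φ : SurfaceGroup γ →* G) :
    LinearMap.range (crossedMap (adjoint G) (genValues φ) (surfaceRelator γ)) ≤
      (derivedIdeal G).toSubmodule := by
  rintro _ ⟨u, rfl⟩
  refine crossed_mem (adjoint G) (adjoint_sub_mem hconn) _ _ ?_
  rw [surfaceRelator, map_list_prod, List.map_ofFn]
  refine List.prod_eq_one fun x hx => ?_
  obtain ⟨i, rfl⟩ := List.mem_ofFn.1 hx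
  simp only [Function.comp_apply, map_mul, map_inv]
  rw [mul_inv_cancel_comm, mul_inv_cancel]

/-- Smoothness is an equality of ranks, but the opposite inequality always holds because the range
lies in `[𝔤,𝔤]`. Only a lower bound on a rank remains, which is what semicontinuity can supply. -/
lemma mem_smoothLocus_iff (hG : IsAlgebraic G) (hconn : IsZariskiConnected G)
    (hred : IsReductive G) (φ : SurfaceGroup γ →* G) :
    φ ∈ smoothLocus γ G ↔ Module.finrank ℝ (lieAlgebra G) ≤ Module.finrank ℝ (LinearMap.range
      (crossedMap (adjoint G) (genValues φ) (surfaceRelator γ))) +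
      Module.finrank ℝ (LieAlgebra.radical ℝ (lieAlgebra G)) := by
  have h1 := finrank_cocycleSpace φ
  have h2 := Submodule.finrank_mono (range_crossedMap_le hconn φ)
  have h3 := finrank_derived_add_finrank_radical_le hG hconn hred
  have h4 : Module.finrank ℝ (derivedIdeal G).toSubmodule = Module.finrank ℝ (derivedIdeal G) := rfl
  change (Module.finrank ℝ (cocycleSpace φ) : ℤ) = vdim γ G ↔ _
  rw [vdim]
  zify at h1 h2 h3 h4 ⊢
  constructor
  · intro h
    linarith
  · intro h
    have h5 : ((Module.finrank ℝ (lieAlgebra G) : ℕ) : ℤ) = Module.finrank ℝ (LinearMap.range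
      (crossedMap (adjoint G) (genValues φ) (surfaceRelator γ))) +
      Module.finrank ℝ (LieAlgebra.radical ℝ (lieAlgebra G)) := by
      apply le_antisymm h
      linarith
    linarith

end cocycles

/-! ### Smooth homomorphisms near the trivial one -/

section deformation

open Filter

variable {n γ : ℕ} {G : Subgroup (GL (Fin n) ℝ)}

/-- Lower semicontinuity of the rank. -/
lemma eventually_finrank_range_le {T E : Type*} [AddCommGroup E] [Module ℝ E] {l : Filter T}
    {F : T → E →ₗ[ℝ] lieAlgebra G} {F₀ : E →ₗ[ℝ] lieAlgebra G}
    (h : ∀ u, Tendsto (fun t => (F t u : Matrix (Fin n) (Fin n) ℝ)) l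
      (𝓝 (F₀ u : Matrix (Fin n) (Fin n) ℝ))) :
    ∀ᶠ t in l, Module.finrank ℝ (LinearMap.range F₀) ≤ Module.finrank ℝ (LinearMap.range (F t)) := by
  let b := Module.finBasis ℝ (LinearMap.range F₀)
  choose u hu using fun i => (b i).2
  have h0 : LinearIndependent ℝ fun i => (F₀ (u i) : Matrix (Fin n) (Fin n) ℝ) := by
    have h1 := (b.linearIndependent.map' (LinearMap.range F₀).subtype
      (Submodule.ker_subtype _)).map' (lieAlgebra G).toSubmodule.subtype (Submodule.ker_subtype _)
    have h2 : (fun i => (F₀ (u i) : Matrix (Fin n) (Fin n) ℝ)) =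
        (lieAlgebra G).toSubmodule.subtype ∘ (LinearMap.range F₀).subtype ∘ b := by
      funext i
      simp [hu]
    rw [h2]
    exact h1
  have h1 := (tendsto_pi_nhds.2 fun i => h (u i)).eventually
    (isOpen_setOfPred_linearIndependent.mem_nhds h0)
  filter_upwards [h1] with t ht
  have h2 : LinearIndependent ℝ fun i => (⟨F t (u i), ⟨u i, rfl⟩⟩ : LinearMap.range (F t)) :=
    LinearIndependent.of_comp ((lieAlgebra G).toSubmodule.subtype ∘ₗ
      (LinearMap.range (F t)).subtype) ht
  have h3 := h2.fintype_card_le_finrank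
  rwa [Fintype.card_fin] at h3

lemma continuous_adjoint_apply {T : Type*} [TopologicalSpace T] {g : T → G}
    {v : T → lieAlgebra G} (hg : Continuous g) (hv : Continuous v) :
    Continuous fun t => adjoint G (g t) (v t) := by
  refine Continuous.subtype_mk ?_ _
  have h1 : Continuous fun t => (g t).1.1 :=
    Units.continuous_val.comp (continuous_subtype_val.comp hg)
  have h2 : Continuous fun t => ((g t).1⁻¹).1 :=
    Units.continuous_val.comp (continuous_inv.comp (continuous_subtype_val.comp hg))
  exact (h1.mul (continuous_subtype_val.comp hv)).mul h2

lemma continuous_lift {S T : Type*} [TopologicalSpace T] {a : T → S → G}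
    (ha : ∀ s, Continuous fun t => a t s) (w : FreeGroup S) :
    Continuous fun t => FreeGroup.lift (a t) w := by
  induction w using FreeGroup.induction_on with
  | C1 => simpa using continuous_const
  | of s => simpa using ha s
  | inv_of s hs =>
    simp only [map_inv]
    exact hs.inv
  | mul x y hx hy =>
    simp only [map_mul]
    exact hx.mul hy

lemma continuous_crossed {S T : Type*} [TopologicalSpace T] {a : T → S → G}
    (ha : ∀ s, Continuous fun t => a t s) (u : S → lieAlgebra G) (w : FreeGroup S) :
    Continuous fun t => crossed (adjoint G) (a t) u w := by
  have hinv : ∀ x, (Continuous fun t => crossed (adjoint G) (a t) u x) →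
      Continuous fun t => crossed (adjoint G) (a t) u x⁻¹ := by
    intro x hx
    simp only [crossed_inv]
    have h1 := continuous_adjoint_apply (continuous_lift ha x).inv hx
    exact Continuous.subtype_mk (continuous_subtype_val.comp h1).neg _
  induction w using FreeGroup.induction_on with
  | C1 => simpa only [crossed_one] using continuous_const
  | of s => simpa only [crossed_of] using continuous_const
  | inv_of s hs => exact hinv _ hs
  | mul x y hx hy =>
    simp only [crossed_mul]
    have h1 := continuous_adjoint_apply (continuous_lift ha x) hy
    exact Continuous.subtype_mk
      ((continuous_subtype_val.comp hx).add (continuous_subtype_val.comp h1)) _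

lemma continuous_genValues (s : Fin γ × Bool) :
    Continuous fun φ : SurfaceGroup γ →* G => genValues φ s :=
  (continuous_apply (PresentedGroup.of s)).comp continuous_induced_dom

lemma isOpen_smoothLocus (hG : IsAlgebraic G) (hconn : IsZariskiConnected G)
    (hred : IsReductive G) : IsOpen (smoothLocus γ G) := by
  rw [isOpen_iff_mem_nhds]
  intro φ hφ
  have h1 := eventually_finrank_range_le (l := 𝓝 φ)
    (F := fun ψ => crossedMap (adjoint G) (genValues ψ) (surfaceRelator γ))
    (F₀ := crossedMap (adjoint G) (genValues φ) (surfaceRelator γ)) (fun u =>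
      (continuous_subtype_val.comp
        (continuous_crossed continuous_genValues u (surfaceRelator γ))).tendsto φ)
  filter_upwards [h1] with ψ hψ
  rw [mem_smoothLocus_iff hG hconn hred] at hφ ⊢
  omega

lemma crossed_list_prod {S H V : Type*} [Group H] [AddCommGroup V] [Module ℝ V]
    (ρ : Representation ℝ H V) (a : S → H) (u : S → V) (l : List (FreeGroup S))
    (hl : ∀ x ∈ l, FreeGroup.lift a x = 1) :
    crossed ρ a u l.prod = (l.map (crossed ρ a u)).sum := by
  induction l with
  | nil => simp [crossed_one]
  | cons x l ih =>
    rw [List.prod_cons, crossed_mul, hl x List.mem_cons_self, map_one, Module.End.one_apply,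
      ih fun y hy => hl y (List.mem_cons_of_mem _ hy), List.map_cons, List.sum_cons]

/-! ### Homomorphisms killing the generators `bᵢ` -/

section handlebody

variable {a : Fin γ × Bool → G} (ha : ∀ i, a (i, true) = 1)

include ha

lemma lift_commutator_eq_one (i : Fin γ) : FreeGroup.lift a
    (FreeGroup.of (i, false) * FreeGroup.of (i, true) *
      (FreeGroup.of (i, false))⁻¹ * (FreeGroup.of (i, true))⁻¹) = 1 := by
  simp [ha]

lemma lift_surfaceRelator_eq_one : FreeGroup.lift a (surfaceRelator γ) = 1 := by
  rw [surfaceRelator, map_list_prod]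
  refine List.prod_eq_one fun x hx => ?_
  obtain ⟨y, hy, rfl⟩ := List.mem_map.1 hx
  obtain ⟨i, rfl⟩ := List.mem_ofFn.1 hy
  exact lift_commutator_eq_one ha i

/-- Only `bᵢ` is varied: at `bᵢ = 1`, the derivative of `aᵢ bᵢ aᵢ⁻¹ bᵢ⁻¹` in the direction `v` is
`Ad(aᵢ) v - v`, and the other commutators do not contribute. -/
lemma adjoint_sub_mem_range (i : Fin γ) (v : lieAlgebra G) : adjoint G (a (i, false)) v - v ∈
    LinearMap.range (crossedMap (adjoint G) a (surfaceRelator γ)) := by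
  refine ⟨Pi.single (i, true) v, ?_⟩
  rw [crossedMap_apply, surfaceRelator, crossed_list_prod, List.map_ofFn, List.sum_ofFn,
    Finset.sum_eq_single i]
  · simp only [Function.comp_apply, crossed_mul, crossed_inv, crossed_of, map_mul, map_inv,
      FreeGroup.lift_apply_of, ha]
    simp [sub_eq_add_neg]
  · intro j _ hj
    simp [crossed_mul, crossed_inv, crossed_of, hj]
  · simp
  · intro x hx
    obtain ⟨i, rfl⟩ := List.mem_ofFn.1 hx
    exact lift_commutator_eq_one ha i

end handlebody

/-- The homomorphism of the surface group which kills the generators `bᵢ` and is given by `c` on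
the generators `aᵢ`. -/
def handlebodyHom (c : Fin γ → G) : SurfaceGroup γ →* G :=
  PresentedGroup.toGroup (f := fun s : Fin γ × Bool => if s.2 then 1 else c s.1) (by
    rintro r rfl
    exact lift_surfaceRelator_eq_one (by simp))

lemma genValues_handlebodyHom (c : Fin γ → G) :
    genValues (handlebodyHom c) = fun s : Fin γ × Bool => if s.2 then 1 else c s.1 := by
  funext s
  exact PresentedGroup.toGroup.of _

lemma continuous_handlebodyHom : Continuous (handlebodyHom (γ := γ) (G := G)) := by
  rw [continuous_induced_rng]
  refine continuous_pi fun x => ?_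
  obtain ⟨w, rfl⟩ := PresentedGroup.mk_surjective _ x
  simp only [Function.comp_apply, ← lift_genValues, genValues_handlebodyHom]
  refine continuous_lift (fun s => ?_) w
  split_ifs
  · exact continuous_const
  · exact continuous_apply _

lemma handlebodyHom_one : handlebodyHom (1 : Fin γ → G) = 1 := by
  ext1 s
  have := congrFun (genValues_handlebodyHom (1 : Fin γ → G)) s
  simpa [genValues] using this

theorem one_mem_closure_smoothLocus (hG : IsAlgebraic G) (hconn : IsZariskiConnected G)
    (hred : IsReductive G) (hγ : 1 < γ) :
    (1 : SurfaceGroup γ →* G) ∈ closure (smoothLocus γ G) := by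
  obtain ⟨X, Y, hXY⟩ := exists_pair_of_isReductive hG hconn hred
  let e : lieAlgebra G → ℝ → G := fun Z t => ⟨expGL (t • Z.1), expGL_mem hG (t • Z).2⟩
  have he : ∀ Z, Continuous (e Z) := fun Z => Continuous.subtype_mk
    (continuous_expGL.comp (continuous_id.smul continuous_const)) _
  have he0 : ∀ Z, e Z 0 = 1 := fun Z => Subtype.ext (by simp [e, expGL_zero])
  let i₀ : Fin γ := ⟨0, by omega⟩
  let i₁ : Fin γ := ⟨1, hγ⟩
  have hi : i₁ ≠ i₀ := by simp [i₀, i₁]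
  -- One handle for `X` and another for `Y`; this is where genus at least two enters.
  let c : ℝ → Fin γ → G := fun t i => if i = i₀ then e X t else if i = i₁ then e Y t else 1
  have hc : Continuous c := by
    refine continuous_pi fun i => ?_
    simp only [c]
    split_ifs
    · exact he X
    · exact he Y
    · exact continuous_const
  have hc0 : c 0 = 1 := by
    funext i
    simp [c, he0]
  -- Rescaling by `t⁻¹` keeps the range inside that of the linearized relator and gives the
  -- nonzero-order limit `(U, V) ↦ ⁅X, U⁆ + ⁅Y, V⁆` as `t → 0`.
  let K : ℝ → lieAlgebra G × lieAlgebra G →ₗ[ℝ] lieAlgebra G := fun t =>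
    t⁻¹ • ((adjoint G (e X t) - LinearMap.id).coprod (adjoint G (e Y t) - LinearMap.id))
  have hslope : ∀ Z U : lieAlgebra G, Tendsto
      (fun t : ℝ => t⁻¹ • ((adjoint G (e Z t) U).1 - U.1)) (𝓝[≠] 0)
      (𝓝 (⁅Z, U⁆ : lieAlgebra G).1) := by
    intro Z U
    have h1 := hasDerivAt_iff_tendsto_slope.1 (hasDerivAt_conj 1 Z.1 U.1)
    simp only [one_mul, inv_one, Units.val_one, mul_one] at h1
    refine h1.congr fun t => ?_
    rw [slope_def_module]
    simp only [sub_zero, zero_smul, expGL_zero, inv_one, Units.val_one, one_mul, mul_one]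
    rfl
  have hK := eventually_finrank_range_le (l := 𝓝[≠] (0 : ℝ)) (F := K)
    (F₀ := (LieAlgebra.ad ℝ (lieAlgebra G) X : lieAlgebra G →ₗ[ℝ] lieAlgebra G).coprod
        (LieAlgebra.ad ℝ (lieAlgebra G) Y : lieAlgebra G →ₗ[ℝ] lieAlgebra G)) (by
    rintro ⟨U, V⟩
    have h1 := (hslope X U).add (hslope Y V)
    refine h1.congr fun t => ?_
    rw [← smul_add]
    rfl)
  have hsmooth : ∀ᶠ t in 𝓝[≠] (0 : ℝ), handlebodyHom (c t) ∈ smoothLocus γ G := by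
    filter_upwards [hK] with t ht
    rw [mem_smoothLocus_iff hG hconn hred]
    have hle : LinearMap.range (K t) ≤ LinearMap.range
        (crossedMap (adjoint G) (genValues (handlebodyHom (c t))) (surfaceRelator γ)) := by
      have hgen : ∀ i v, adjoint G (c t i) v - v ∈ LinearMap.range
          (crossedMap (adjoint G) (genValues (handlebodyHom (c t))) (surfaceRelator γ)) := by
        intro i v
        have := adjoint_sub_mem_range (a := genValues (handlebodyHom (c t)))
          (by simp [genValues_handlebodyHom]) i v
        rw [genValues_handlebodyHom] at this ⊢
        simpa using this
      rintro _ ⟨⟨U, V⟩, rfl⟩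
      have hU := hgen i₀ U
      have hV := hgen i₁ V
      simp only [c, if_true, if_neg hi] at hU hV
      exact Submodule.smul_mem _ _ (Submodule.add_mem _ hU hV)
    have := Submodule.finrank_mono hle
    omega
  have hlim : Tendsto (fun t => handlebodyHom (c t)) (𝓝[≠] (0 : ℝ))
      (𝓝 (1 : SurfaceGroup γ →* G)) := by
    have h1 := ((continuous_handlebodyHom.comp hc).tendsto 0).mono_left
      (nhdsWithin_le_nhds (s := {0}ᶜ))
    rwa [Function.comp_apply, hc0, handlebodyHom_one] at h1
  exact mem_closure_of_tendsto hlim hsmooth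

end deformation

end SurfaceRep

end

theorem mainTheorem5 (n : ℕ) (G : Subgroup (GL (Fin n) ℝ))
    (hG : SurfaceRep.IsAlgebraic G) (hconn : SurfaceRep.IsZariskiConnected G)
    (hred : SurfaceRep.IsReductive G) (γ : ℕ) (hγ : 1 < γ) :
    (1 : SurfaceRep.SurfaceGroup γ →* G) ∈
        closure {φ : SurfaceRep.SurfaceGroup γ →* G | SurfaceRep.IsFlexible φ} ∧
      (1 : SurfaceRep.SurfaceGroup γ →* G) ∈ closure (SurfaceRep.smoothLocus γ G) := by
  have h := SurfaceRep.one_mem_closure_smoothLocus hG hconn hred hγ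
  refine ⟨closure_mono (fun φ hφ => ?_) h, h⟩
  exact ⟨_, (SurfaceRep.isOpen_smoothLocus hG hconn hred).mem_nhds hφ, subset_closure⟩
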